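/- Let $n\ge 2$, let $\Omega\subset\mathbb{R}^n$ be a bounded Lipschitz domain with unit exterior normal $\nu$, and let $k>0$. All functions are real valued. For $q\in L^\infty(\Omega)$ and $g\in L^2(\partial\Omega)$ consider the Neumann problem $\Delta u+k^2qu=0$ in $\Omega$, $\partial_\nu u=g$ on $\partial\Omega$, in the weak sense $$\int_\Omega(\nabla u\cdot\nabla v-k^2quv)\,dx=\int_{\partial\Omega}gv\,ds\qquad\text{for all }v\in H^1(\Omega),$$ with $u\in H^1(\Omega)$. Let $\mathcal{D}(\Lambda)\subset L^\infty(\Omega)$ be the set of all $q$ for which the homogeneous problem ($g=0$) has only the trivial solution. For $q\in\mathcal{D}(\Lambda)$ the Neumann problem has exactly one solution $u$ for every $g\in L^2(\partial\Omega)$, and the Neumann-to-Dirichlet operator $\Lambda(q):g\mapsto u|_{\partial\Omega}$ is a bounded linear operator on $L^2(\partial\Omega)$. The map $q\mapsto\Lambda(q)$, from $\mathcal{D}(\Lambda)\subset L^\infty(\Omega)$ to the bounded operators on $L^2(\partial\Omega)$, is Fréchet differentiable at every $q_0\in\mathcal{D}(\Lambda)$, with derivative denoted by $\Lambda'(q_0)$.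 Let $q,q_0\in\mathcal{D}(\Lambda)$. Then the number $d(q)$ of negative Neumann eigenvalues of $-(\Delta+k^2q)$, counted with multiplicity, is finite, and there is a subspace $V_1\subset L^2(\partial\Omega)$ with $\dim V_1\le d(q)$ such that $$\int_{\partial\Omega}g\,\bigl(\Lambda(q)-\Lambda(q_0)-\Lambda'(q_0)(q-q_0)\bigr)g\,ds\ \ge\ 0\qquad\text{for all }g\in V_1^{\perp}.$$ -/

import Mathlib

open MeasureTheory Filter Topology
open scoped ENNReal NNReal ContDiff

noncomputable section

namespace Helmholtz

/-- Euclidean space `ℝⁿ`. -/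
abbrev E (n : ℕ) := EuclideanSpace ℝ (Fin n)

variable {n : ℕ}

/-- `Ω` is a bounded Lipschitz domain: open, connected (in particular nonempty), bounded, and near
every boundary point `x` it is the part of a ball around `x` that lies strictly above the graph of
a Lipschitz function over the hyperplane orthogonal to some unit vector `e`
(`y - ⟪e, y⟫ e` is the orthogonal projection of `y` onto that hyperplane). -/
structure IsBoundedLipschitzDomain (Ω : Set (E n)) : Prop where
  isOpen : IsOpen Ω
  isConnected : IsConnected Ω
  isBounded : Bornology.IsBounded Ω
  lipschitz_boundary : ∀ x ∈ frontier Ω, ∃ (e : E n) (f : E n → ℝ) (K : ℝ≥0) (r : ℝ),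
    ‖e‖ = 1 ∧ LipschitzWith K f ∧ 0 < r ∧
      ∀ y ∈ Metric.ball x r, y ∈ Ω ↔ f (y - inner ℝ e y • e) < inner ℝ e y

/-- Surface measure on `∂Ω`: the `(n-1)`-dimensional Hausdorff measure, normalized so as to agree
with Lebesgue measure on `ℝⁿ⁻¹`. -/
def surfaceMeasure (Ω : Set (E n)) : Measure (E n) :=
  (μHE[n - 1] : Measure (E n)).restrict (frontier Ω)

/-- `L²(Ω)`, real valued. -/
abbrev L2 (Ω : Set (E n)) := Lp ℝ 2 (volume.restrict Ω)

/-- `L²(Ω; ℝⁿ)`. -/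
abbrev L2Vec (Ω : Set (E n)) := Lp (E n) 2 (volume.restrict Ω)

/-- `L^∞(Ω)`, real valued. -/
abbrev LInf (Ω : Set (E n)) := Lp ℝ ∞ (volume.restrict Ω)

/-- `L²(∂Ω)`, real valued. -/
abbrev L2Bdry (Ω : Set (E n)) := Lp ℝ 2 (surfaceMeasure Ω)

/-- `w` is the weak gradient of `u` in `Ω`:
`∫_Ω u ∂_e φ = - ∫_Ω (w · e) φ` for all directions `e` and all `φ ∈ C_c^∞(Ω)`. -/
def IsWeakGradient (Ω : Set (E n)) (u : L2 Ω) (w : L2Vec Ω) : Prop :=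
  ∀ φ : E n → ℝ, ContDiff ℝ ∞ φ → HasCompactSupport φ → tsupport φ ⊆ Ω → ∀ e : E n,
    ∫ x in Ω, u x * fderiv ℝ φ x e = - ∫ x in Ω, inner ℝ (w x) e * φ x

theorem integrable_mul_test {Ω : Set (E n)} (u : L2 Ω) {ψ : E n → ℝ} (hψ : Continuous ψ)
    (hc : HasCompactSupport ψ) : Integrable (fun x => u x * ψ x) (volume.restrict Ω) :=
  (Lp.memLp u).integrable_mul (q := 2) (hψ.memLp_of_hasCompactSupport hc)

theorem integrable_inner_mul_test {Ω : Set (E n)} (w : L2Vec Ω) (e : E n) {ψ : E n → ℝ}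
    (hψ : Continuous ψ) (hc : HasCompactSupport ψ) :
    Integrable (fun x => inner ℝ (w x) e * ψ x) (volume.restrict Ω) :=
  ((Lp.memLp w).inner_const e).integrable_mul (q := 2) (hψ.memLp_of_hasCompactSupport hc)

/-- The Sobolev space `H¹(Ω)` of all `u ∈ L²(Ω)` with a weak gradient in `L²(Ω; ℝⁿ)`, realized as
the space of pairs `(u, ∇u)` inside `L²(Ω) × L²(Ω; ℝⁿ)`; the induced norm is the `H¹` norm
`(‖u‖² + ‖∇u‖²)^{1/2}`. -/
def H1 (Ω : Set (E n)) : Submodule ℝ (WithLp 2 (L2 Ω × L2Vec Ω)) where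
  carrier := {p | IsWeakGradient Ω p.fst p.snd}
  zero_mem' := by
    intro φ _ _ _ e
    have h1 : ∀ᵐ x ∂(volume.restrict Ω), ((0 : L2 Ω) : E n → ℝ) x * fderiv ℝ φ x e = 0 := by
      filter_upwards [Lp.coeFn_zero ℝ 2 (volume.restrict Ω)] with x hx
      rw [hx, Pi.zero_apply, zero_mul]
    have h2 : ∀ᵐ x ∂(volume.restrict Ω), inner ℝ (((0 : L2Vec Ω) : E n → E n) x) e * φ x = 0 := by
      filter_upwards [Lp.coeFn_zero (E n) 2 (volume.restrict Ω)] with x hx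
      rw [hx, Pi.zero_apply, inner_zero_left, zero_mul]
    simp only [WithLp.zero_fst, WithLp.zero_snd]
    rw [integral_congr_ae h1, integral_congr_ae h2]
    simp
  add_mem' := by
    intro p q hp hq φ hφ hc hs e
    have hd : Continuous fun x => fderiv ℝ φ x e :=
      (hφ.continuous_fderiv (by simp)).clm_apply continuous_const
    have hdc : HasCompactSupport fun x => fderiv ℝ φ x e := hc.fderiv_apply ℝ e
    have h1 : ∀ᵐ x ∂(volume.restrict Ω), (p.fst + q.fst : L2 Ω) x * fderiv ℝ φ x e
        = p.fst x * fderiv ℝ φ x e + q.fst x * fderiv ℝ φ x e := by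
      filter_upwards [Lp.coeFn_add p.fst q.fst] with x hx
      rw [hx, Pi.add_apply, add_mul]
    have h2 : ∀ᵐ x ∂(volume.restrict Ω), inner ℝ ((p.snd + q.snd : L2Vec Ω) x) e * φ x
        = inner ℝ (p.snd x) e * φ x + inner ℝ (q.snd x) e * φ x := by
      filter_upwards [Lp.coeFn_add p.snd q.snd] with x hx
      rw [hx, Pi.add_apply, inner_add_left, add_mul]
    simp only [WithLp.add_fst, WithLp.add_snd]
    rw [integral_congr_ae h1, integral_congr_ae h2,
      integral_add (integrable_mul_test _ hd hdc) (integrable_mul_test _ hd hdc),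
      integral_add (integrable_inner_mul_test _ e hφ.continuous hc)
        (integrable_inner_mul_test _ e hφ.continuous hc),
      hp φ hφ hc hs e, hq φ hφ hc hs e]
    ring
  smul_mem' := by
    intro c p hp φ hφ hc hs e
    have h1 : ∀ᵐ x ∂(volume.restrict Ω), (c • p.fst : L2 Ω) x * fderiv ℝ φ x e
        = c * (p.fst x * fderiv ℝ φ x e) := by
      filter_upwards [Lp.coeFn_smul c p.fst] with x hx
      rw [hx, Pi.smul_apply, smul_eq_mul, mul_assoc]
    have h2 : ∀ᵐ x ∂(volume.restrict Ω), inner ℝ ((c • p.snd : L2Vec Ω) x) e * φ x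
        = c * (inner ℝ (p.snd x) e * φ x) := by
      filter_upwards [Lp.coeFn_smul c p.snd] with x hx
      rw [hx, Pi.smul_apply, real_inner_smul_left, mul_assoc]
    simp only [WithLp.smul_fst, WithLp.smul_snd]
    rw [integral_congr_ae h1, integral_congr_ae h2, integral_const_mul, integral_const_mul,
      hp φ hφ hc hs e]
    ring

/-- The function underlying an element of `H¹(Ω)`. -/
abbrev val {Ω : Set (E n)} (u : H1 Ω) : L2 Ω := (u : WithLp 2 (L2 Ω × L2Vec Ω)).fst

/-- The weak gradient of an element of `H¹(Ω)`. -/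
abbrev grad {Ω : Set (E n)} (u : H1 Ω) : L2Vec Ω := (u : WithLp 2 (L2 Ω × L2Vec Ω)).snd

/-- `τ ∈ L²(∂Ω)` is the boundary trace of `u ∈ H¹(Ω)`: there are smooth functions `φ j` on `ℝⁿ` with
`φ j → u` in `H¹(Ω)` and `φ j |_{∂Ω} → τ` in `L²(∂Ω)`. In other words, the trace is the continuous
extension of the restriction map `φ ↦ φ|_{∂Ω}` from smooth functions to `H¹(Ω)`. -/
def IsTrace {Ω : Set (E n)} (u : H1 Ω) (τ : L2Bdry Ω) : Prop :=
  ∃ φ : ℕ → E n → ℝ, (∀ j, ContDiff ℝ ∞ (φ j)) ∧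
    Tendsto (fun j => eLpNorm (fun x => φ j x - val u x) 2 (volume.restrict Ω)) atTop (𝓝 0) ∧
    Tendsto (fun j => eLpNorm (fun x => gradient (φ j) x - grad u x) 2 (volume.restrict Ω))
      atTop (𝓝 0) ∧
    Tendsto (fun j => eLpNorm (fun x => φ j x - τ x) 2 (surfaceMeasure Ω)) atTop (𝓝 0)

/-- The bilinear form `∫_Ω (∇u · ∇v - k² q u v) dx` of `-(Δ + k² q)` on `H¹(Ω)`. -/
def form {Ω : Set (E n)} (k : ℝ) (q : LInf Ω) (u v : H1 Ω) : ℝ :=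
  ∫ x in Ω, (inner ℝ (grad u x) (grad v x) - k ^ 2 * q x * val u x * val v x)

/-- `u ∈ H¹(Ω)` is a weak solution of `Δu + k² q u = 0` in `Ω`, `∂_ν u = g` on `∂Ω`:
`∫_Ω (∇u · ∇v - k² q u v) dx = ∫_{∂Ω} g v ds` for all `v ∈ H¹(Ω)`, where `v|_{∂Ω}` is the
trace `τ` of `v`. -/
def IsWeakSolution {Ω : Set (E n)} (k : ℝ) (q : LInf Ω) (g : L2Bdry Ω) (u : H1 Ω) : Prop :=
  ∀ (v : H1 Ω) (τ : L2Bdry Ω), IsTrace v τ → form k q u v = ∫ x, g x * τ x ∂(surfaceMeasure Ω)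

/-- `u ∈ H¹(Ω)` is nonzero and satisfies `-(Δ + k² q) u = μ u` in `Ω`, `∂_ν u = 0` on `∂Ω`, in the
weak sense. -/
def IsNeumannEigenfunction {Ω : Set (E n)} (k : ℝ) (q : LInf Ω) (μ : ℝ) (u : H1 Ω) : Prop :=
  u ≠ 0 ∧ ∀ v : H1 Ω, form k q u v = μ * ∫ x in Ω, val u x * val v x

/-- `L_k(Ω)`: the set of all `q ∈ L^∞(Ω)` for which `k` is a resonance frequency, that is, for which
the homogeneous Neumann problem `Δu + k² q u = 0`, `∂_ν u = 0` has a nontrivial solution in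
`H¹(Ω)`. -/
def resonantSet (Ω : Set (E n)) (k : ℝ) : Set (LInf Ω) :=
  {q | ∃ u : H1 Ω, u ≠ 0 ∧ ∀ v : H1 Ω, form k q u v = 0}

/-- `𝒟(Λ) = L^∞(Ω) \ L_k(Ω)`. -/
def ntdDomain (Ω : Set (E n)) (k : ℝ) : Set (LInf Ω) := (resonantSet Ω k)ᶜ

/-- `T` is the Neumann-to-Dirichlet operator of `Δu + k² q u = 0`: for every `g ∈ L²(∂Ω)` the
Neumann problem with data `g` has exactly one weak solution `u`, and `T g` is the trace of `u`. -/
def IsNtD {Ω : Set (E n)} (k : ℝ) (q : LInf Ω) (T : L2Bdry Ω →L[ℝ] L2Bdry Ω) : Prop :=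
  ∀ g : L2Bdry Ω, ∃ u : H1 Ω, (IsWeakSolution k q g u ∧ ∀ u', IsWeakSolution k q g u' → u' = u) ∧
    IsTrace u (T g)

open Classical in
/-- The Neumann-to-Dirichlet operator `Λ(q)` as a bounded operator on `L²(∂Ω)`
(with value `0` where there is none, that is, outside `𝒟(Λ)`). -/
def ntd {Ω : Set (E n)} (k : ℝ) (q : LInf Ω) : L2Bdry Ω →L[ℝ] L2Bdry Ω :=
  if h : ∃ T, IsNtD k q T then h.choose else 0

/-- The span of all Neumann eigenfunctions of `-(Δ + k² q)` with negative eigenvalue, that is, the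
sum of the eigenspaces of all negative Neumann eigenvalues. -/
def negativeEigenspaces {Ω : Set (E n)} (k : ℝ) (q : LInf Ω) : Submodule ℝ (H1 Ω) :=
  Submodule.span ℝ {u | ∃ μ : ℝ, μ < 0 ∧ IsNeumannEigenfunction k q μ u}

/-- `d(q)`: the number of negative Neumann eigenvalues of `-(Δ + k² q)`, counted with multiplicity.
Eigenspaces of different eigenvalues are linearly independent, so this is the dimension of their
sum. -/
def numNegativeEigenvalues {Ω : Set (E n)} (k : ℝ) (q : LInf Ω) : ℕ :=
  Module.finrank ℝ (negativeEigenspaces k q)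

end Helmholtz

end

/-! Write `A` and `A₀` for the self-adjoint operators on `H¹(Ω)` representing the forms of `q` and
`q₀`, `γ` for the trace and `γ†` for its adjoint. Then `Λ(q) = γ A⁻¹ γ†`. Since `A` depends affinely
on `q`, the derivative of the inverse gives `Λ'(q₀)(q - q₀) = γ A₀⁻¹ (A₀ - A) A₀⁻¹ γ†`.

For `u = A⁻¹ γ† g` and `u₀ = A₀⁻¹ γ† g`, expanding with the symmetry of `A` and `A₀` shows that the
quadratic form of the remainder at `g` is exactly `⟨A (u - u₀), u - u₀⟩`. This is nonnegative as
soon as `u - u₀` is `L²`-orthogonal to every eigenfunction `φ` with eigenvalue `μ < 0`. Now `A (u -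
u₀) = (A₀ - A) u₀`, so `μ ∫ (u - u₀) φ = ⟨(A₀ - A) u₀, φ⟩ = ⟨g, γ A₀⁻¹ (A₀ - A) φ⟩`. Hence `V₁` is
the image of the negative eigenspaces under `γ A₀⁻¹ (A₀ - A)`, and its dimension is at most `d(q)`.
This is `exists_inner_remainder_nonneg`.

The spectral input is a Gårding inequality together with compactness of `H¹(Ω) → L²(Ω)`. They make
the negative eigenspaces finite dimensional (`finiteDimensional_negativeSpan`), the form nonnegative
on their `L²`-complement (`inner_self_nonneg_of_orthogonal_negativeSpan`), and `A` invertible once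
it is injective.

The analytic input on a Lipschitz domain is proved from its local graphs: density of smooth
functions (`exists_smooth_approx`), Rellich's theorem (`isCompactOperator_valL`) and the trace
theorem (`exists_trace`). -/

noncomputable section

namespace Helmholtz

/-! ### Spectral theory of a symmetric form relative to a compact embedding -/

section SpectralTheory

variable {H L : Type*} [NormedAddCommGroup H] [InnerProductSpace ℝ H]
  [NormedAddCommGroup L] [InnerProductSpace ℝ L]

/-- A compact operator that is bounded below on a subspace forces it to be finite dimensional. -/
theorem finiteDimensional_of_isCompactOperator_of_bound [CompleteSpace H] (ι : H →L[ℝ] L) (hι : IsCompactOperator ι)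
    (N : Submodule ℝ H) (C : ℝ) (hN : ∀ u ∈ N, ‖u‖ ≤ C * ‖ι u‖) : FiniteDimensional ℝ N := by
  set M := N.topologicalClosure
  have hM : ∀ u ∈ M, ‖u‖ ≤ C * ‖ι u‖ := by
    have hcl : IsClosed {u : H | ‖u‖ ≤ C * ‖ι u‖} :=
      isClosed_le continuous_norm (by fun_prop)
    intro u hu
    have : closure (N : Set H) ⊆ {u : H | ‖u‖ ≤ C * ‖ι u‖} := closure_minimal hN hcl
    exact this hu
  let j : M →L[ℝ] L := ι.comp M.subtypeL
  have hj : AntilipschitzWith C.toNNReal j :=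
    ContinuousLinearMap.antilipschitz_of_bound j fun u =>
      (hM u u.2).trans (mul_le_mul_of_nonneg_right (Real.le_coe_toNNReal C) (norm_nonneg _))
  have hMc : CompleteSpace M := N.isClosed_topologicalClosure.completeSpace_coe
  have hemb : IsClosedEmbedding j := hj.isClosedEmbedding j.uniformContinuous
  obtain ⟨K, hK, hKj⟩ := hι.comp_clm M.subtypeL
  -- The set `j ⁻¹' K` is a neighbourhood of zero in `M`, and it is compact because `j` is a closed
  -- embedding; so `M` is locally compact.
  have : FiniteDimensional ℝ M := FiniteDimensional.of_isCompactOperator_id (𝕜 := ℝ)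
    ⟨j ⁻¹' K, hemb.isCompact_preimage hK, hKj⟩
  exact Submodule.finiteDimensional_of_le N.le_topologicalClosure

/-- The span of the solutions of `A u = μ ι† ι u` with `μ < 0`. -/
def negativeSpan (A : H →L[ℝ] H) (ι : H →L[ℝ] L) : Submodule ℝ H :=
  Submodule.span ℝ {u | ∃ μ : ℝ, μ < 0 ∧ ∀ v, inner ℝ (A u) v = μ * inner ℝ (ι u) (ι v)}

/-- Eigenvectors of different eigenvalues are orthogonal both for `A` and for the pulled-back `L`
product. The form is therefore diagonal on the sum of the eigenspaces, with entries `μ ‖ι f‖² ≤ 0`.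
-/
theorem inner_self_le_zero_of_mem_negativeSpan {A : H →L[ℝ] H} {ι : H →L[ℝ] L}
    (hA : ∀ u v, inner ℝ (A u) v = inner ℝ (A v) u) {u : H} (hu : u ∈ negativeSpan A ι) :
    inner ℝ (A u) u ≤ 0 := by
  let F : {μ : ℝ // μ < 0} → Submodule ℝ H := fun μ =>
    { carrier := {u | ∀ v, inner ℝ (A u) v = (μ : ℝ) * inner ℝ (ι u) (ι v)}
      zero_mem' := by simp
      add_mem' := by
        intro a b ha hb v
        simp only [map_add, inner_add_left, ha v, hb v]; ring
      smul_mem' := by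
        intro c a ha v
        simp only [map_smul, real_inner_smul_left, ha v]; ring }
  have hle : negativeSpan A ι ≤ ⨆ μ, F μ := by
    refine Submodule.span_le.2 ?_
    rintro u ⟨μ, hμ, h⟩
    exact Submodule.mem_iSup_of_mem (⟨μ, hμ⟩ : {μ : ℝ // μ < 0}) h
  obtain ⟨f, hf, rfl⟩ := (Submodule.mem_iSup_iff_exists_finsupp F u).1 (hle hu)
  rw [Finsupp.sum, map_sum, sum_inner]
  refine Finset.sum_nonpos fun μ _ => ?_
  rw [inner_sum, ]
  have horth : ∀ ν, ν ≠ μ → inner ℝ (A (f μ)) (f ν) = (0 : ℝ) := by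
    intro ν hν
    have h1 := hf μ (f ν)
    have h2 := hf ν (f μ)
    have h3 := hA (f μ) (f ν)
    rw [real_inner_comm (ι (f μ)) (ι (f ν))] at h2
    have h4 : ((ν : ℝ) - μ) * inner ℝ (ι (f μ)) (ι (f ν)) = 0 := by
      rw [sub_mul, ← h2, ← h1, h3, sub_self]
    have h5 : (ν : ℝ) - μ ≠ 0 := sub_ne_zero.2 fun h => hν (Subtype.ext h)
    rw [h1, (mul_eq_zero.1 h4).resolve_left h5, mul_zero]
  rw [Finset.sum_eq_single μ (fun ν _ hν => horth ν hν)]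
  · rw [hf μ (f μ)]
    exact mul_nonpos_of_nonpos_of_nonneg μ.2.le real_inner_self_nonneg
  · intro h
    rw [Finsupp.notMem_support_iff.1 h]; simp

/-- Where the form is nonpositive, the Gårding inequality `hco` becomes `‖u‖² ≤ c ‖ι u‖²`, which a
compact `ι` allows only in finite dimension. -/
theorem finiteDimensional_negativeSpan [CompleteSpace H] {A : H →L[ℝ] H} {ι : H →L[ℝ] L} {c : ℝ}
    (hA : ∀ u v, inner ℝ (A u) v = inner ℝ (A v) u) (hι : IsCompactOperator ι) (hc : 0 < c)
    (hco : ∀ u, ‖u‖ ^ 2 ≤ inner ℝ (A u) u + c * ‖ι u‖ ^ 2) :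
    FiniteDimensional ℝ (negativeSpan A ι) := by
  refine finiteDimensional_of_isCompactOperator_of_bound ι hι _ (√c) fun u hu => ?_
  have h := inner_self_le_zero_of_mem_negativeSpan hA hu
  refine le_of_sq_le_sq ?_ (by positivity)
  rw [mul_pow, Real.sq_sqrt hc.le]
  linarith [hco u]

/-- On an invariant subspace on which all eigenvalues of a compact symmetric operator lie in
`[-r, r]`, the operator has norm at most `r`. -/
theorem norm_le_of_eigenvalues_le (T : L →L[ℝ] L) (hT : IsCompactOperator T)
    (hT' : (T : L →ₗ[ℝ] L).IsSymmetric)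
    (X : Submodule ℝ L) [CompleteSpace X] (hX : ∀ x ∈ X, T x ∈ X) {r : ℝ} (hr : 0 ≤ r)
    (hev : ∀ (l : ℝ), ∀ x ∈ X, x ≠ 0 → T x = l • x → |l| ≤ r) (x : L) (hx : x ∈ X) :
    ‖T x‖ ≤ r * ‖x‖ := by
  let S : X →L[ℝ] X := T.restrict hX
  have hS_compact : IsCompactOperator S := hT.restrict' hX
  have hS_symm : (S : X →ₗ[ℝ] X).IsSymmetric := hT'.restrict_invariant hX
  have hS : ‖S‖ ≤ r := by
    -- The norm of a self-adjoint operator is its spectral radius, and every nonzero spectral value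
    -- of a compact operator is an eigenvalue.
    have h : spectralRadius ℝ S ≤ ENNReal.ofReal r := by
      refine iSup₂_le fun l hl => ?_
      rcases eq_or_ne l 0 with rfl | hl0
      · simp
      obtain ⟨y, hy⟩ := ((hS_compact.hasEigenvalue_iff_mem_spectrum hl0).2 hl).exists_hasEigenvector
      have hy1 : T y = l • (y : L) := congrArg Subtype.val hy.apply_eq_smul
      have := hev l y y.2 (fun h => hy.2 (Subtype.ext h)) hy1
      rw [← enorm_eq_nnnorm, Real.enorm_eq_ofReal_abs]
      exact ENNReal.ofReal_le_ofReal this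
    rw [S.spectralRadius_eq_nnnorm hS_symm.isSelfAdjoint, ← enorm_eq_nnnorm,
      ← ofReal_norm] at h
    exact (ENNReal.ofReal_le_ofReal_iff hr).1 h
  calc ‖T x‖ = ‖S ⟨x, hx⟩‖ := rfl
    _ ≤ ‖S‖ * ‖(⟨x, hx⟩ : X)‖ := S.le_opNorm _
    _ ≤ r * ‖x‖ := mul_le_mul_of_nonneg_right hS (norm_nonneg _)

/-- Lax–Milgram. -/
theorem exists_rightInverse_of_coercive [CompleteSpace H] {A : H →L[ℝ] H} (hA : ∀ u, ‖u‖ ^ 2 ≤ inner ℝ (A u) u) :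
    ∃ S : H →L[ℝ] H, (∀ u, A (S u) = u) := by
  let B : H →L[ℝ] H →L[ℝ] ℝ := (innerSL ℝ).comp A
  have hB : IsCoercive B := ⟨1, one_pos, fun u => by
    simpa [B, sq, innerSL_apply_apply] using hA u⟩
  let e := hB.continuousLinearEquivOfBilin
  have he : ∀ u, e u = A u := fun u =>
    ext_inner_right ℝ fun v => hB.continuousLinearEquivOfBilin_apply u v
  exact ⟨e.symm, fun u => by rw [← he]; exact e.apply_symm_apply u⟩

/-- A symmetric form with compact perturbation is nonnegative on the complement of its negative
eigenspaces. -/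
theorem inner_self_nonneg_of_orthogonal_negativeSpan [CompleteSpace H] [CompleteSpace L]
    {A : H →L[ℝ] H} {ι : H →L[ℝ] L} {c : ℝ}
    (hA : ∀ u v, inner ℝ (A u) v = inner ℝ (A v) u) (hι : IsCompactOperator ι) (hc : 0 < c)
    (hco : ∀ u, ‖u‖ ^ 2 ≤ inner ℝ (A u) u + c * ‖ι u‖ ^ 2) {w : H}
    (hw : ∀ φ ∈ negativeSpan A ι, inner ℝ (ι w) (ι φ) = (0 : ℝ)) :
    0 ≤ inner ℝ (A w) w := by
  let ι' := ContinuousLinearMap.adjoint ι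
  have hadj : ∀ y v, inner ℝ (ι' y) v = inner ℝ y (ι v) :=
    fun y v => ContinuousLinearMap.adjoint_inner_left ι v y
  let Ac : H →L[ℝ] H := A + c • ι'.comp ι
  have hAc : ∀ u v, inner ℝ (Ac u) v = inner ℝ (A u) v + c * inner ℝ (ι u) (ι v) := by
    intro u v
    simp [Ac, inner_add_left, real_inner_smul_left, hadj]
  have hAcs : ∀ u v, inner ℝ (Ac u) v = inner ℝ (Ac v) u := by
    intro u v
    rw [hAc, hAc, hA u v, real_inner_comm (ι u) (ι v)]
  have hAcco : ∀ u, ‖u‖ ^ 2 ≤ inner ℝ (Ac u) u := by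
    intro u
    rw [hAc, real_inner_self_eq_norm_sq]; exact hco u
  obtain ⟨S, hS⟩ := exists_rightInverse_of_coercive hAcco
  -- If `T y = l y` with `l > 0`, then `x = S (ι' y)` satisfies `A x = (1/l - c) ι' (ι x)`. Negative
  -- eigenvalues of the form thus correspond to `l > 1/c`, and away from them `T` is bounded by
  -- `1/c`.
  let T : L →L[ℝ] L := ι.comp (S.comp ι')
  have hTin : ∀ y z, inner ℝ (T y) z = inner ℝ (Ac (S (ι' y))) (S (ι' z)) := by
    intro y z
    have : inner ℝ (T y) z = inner ℝ (ι' z) (S (ι' y)) := by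
      rw [hadj, real_inner_comm]; rfl
    rw [this, hAcs, hS (ι' z)]
  have hTc : IsCompactOperator T := hι.comp_clm (S.comp ι')
  have hTs : (T : L →ₗ[ℝ] L).IsSymmetric := by
    intro y z
    change inner ℝ (T y) z = inner ℝ y (T z)
    rw [hTin, hAcs, ← hTin, real_inner_comm]
  -- eigenvectors of `T` with eigenvalue larger than `1 / c` come from the negative span
  let Y : Set L := {y | ∃ l : ℝ, 1 / c < l ∧ T y = l • y}
  let X : Submodule ℝ L := (Submodule.span ℝ Y)ᗮ
  have hXY : ∀ x ∈ X, ∀ y ∈ Y, inner ℝ y x = (0 : ℝ) := fun x hx y hy =>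
    (Submodule.mem_orthogonal _ _).1 hx y (Submodule.subset_span hy)
  have hYX : ∀ x, (∀ y ∈ Y, inner ℝ y x = (0 : ℝ)) → x ∈ X := by
    intro x h
    refine (Submodule.mem_orthogonal _ _).2 fun u hu => ?_
    induction hu using Submodule.span_induction with
    | mem y hy => exact h y hy
    | zero => simp
    | add a b _ _ ha hb => rw [inner_add_left, ha, hb, add_zero]
    | smul r a _ ha => rw [real_inner_smul_left, ha, mul_zero]
  have hXT : ∀ x ∈ X, T x ∈ X := by
    intro x hx
    refine hYX _ fun y hy => ?_
    have : inner ℝ (T y) x = inner ℝ y (T x) := hTs y x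
    obtain ⟨l, hl, hTy⟩ := id hy
    rw [← this, hTy, real_inner_smul_left, hXY x hx y hy, mul_zero]
  have hwX : ι w ∈ X := by
    refine hYX _ ?_
    rintro y ⟨l, hl, hTy⟩
    have hl0 : 0 < l := (by positivity : (0 : ℝ) < 1 / c).trans hl
    have hyN : S (ι' y) ∈ negativeSpan A ι := by
      refine Submodule.subset_span ⟨1 / l - c, ?_, fun v => ?_⟩
      · rw [sub_neg, div_lt_comm₀ hl0 hc]; exact hl
      · have h1 := hAc (S (ι' y)) v
        rw [hS, hadj] at h1
        have h2 : ι (S (ι' y)) = l • y := hTy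
        rw [h2, real_inner_smul_left] at h1 ⊢
        rw [sub_mul, ← mul_assoc, one_div_mul_cancel hl0.ne', one_mul, ← mul_assoc] at *
        linarith
    have h0 := hw _ hyN
    have h2 : ι (S (ι' y)) = l • y := hTy
    rw [h2, real_inner_smul_right] at h0
    rw [real_inner_comm]
    exact (mul_eq_zero.1 h0).resolve_left hl0.ne'
  have hTpos : ∀ y, 0 ≤ inner ℝ (T y) y := fun y => by
    rw [hTin]; exact (sq_nonneg _).trans (hAcco _)
  have hTX := norm_le_of_eigenvalues_le T hTc hTs X hXT (r := 1 / c) (by positivity) (by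
    intro l x hx hx0 hTx
    have h1 := hTpos x
    have hx2 : 0 < inner ℝ x x := real_inner_self_pos.2 hx0
    rw [hTx, real_inner_smul_left] at h1
    have hl : 0 ≤ l := nonneg_of_mul_nonneg_left h1 hx2
    rw [abs_of_nonneg hl]
    by_contra! hlt
    exact hx2.ne' (hXY x hx x ⟨l, hlt, hTx⟩)) (ι w) hwX
  -- Cauchy-Schwarz for the form of `Ac`
  set z := S (ι' (ι w))
  have hz1 : inner ℝ (Ac z) w = ‖ι w‖ ^ 2 := by
    rw [hS, hadj, real_inner_self_eq_norm_sq]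
  have hz2 : inner ℝ (Ac z) z ≤ 1 / c * ‖ι w‖ ^ 2 := by
    rw [← hTin]
    calc inner ℝ (T (ι w)) (ι w) ≤ ‖T (ι w)‖ * ‖ι w‖ := real_inner_le_norm _ _
      _ ≤ 1 / c * ‖ι w‖ * ‖ι w‖ := mul_le_mul_of_nonneg_right hTX (norm_nonneg _)
      _ = _ := by ring
  -- Expanding gives `⟨Ac w, w⟩ ≥ 2c ‖ι w‖² - c² ⟨Ac z, z⟩ ≥ c ‖ι w‖²`; this cancels exactly the
  -- term `c ‖ι w‖²` added to `A` in `Ac`.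
  have hpos : 0 ≤ inner ℝ (Ac (w - c • z)) (w - c • z) := (sq_nonneg _).trans (hAcco _)
  have hexp : inner ℝ (Ac (w - c • z)) (w - c • z)
      = inner ℝ (Ac w) w - 2 * c * inner ℝ (Ac z) w + c ^ 2 * inner ℝ (Ac z) z := by
    simp only [map_sub, map_smul, inner_sub_left, inner_sub_right, real_inner_smul_left,
      real_inner_smul_right, hAcs w z]
    ring
  rw [hexp, hz1, hAc, real_inner_self_eq_norm_sq] at hpos
  have : c ^ 2 * inner ℝ (Ac z) z ≤ c ^ 2 * (1 / c * ‖ι w‖ ^ 2) :=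
    mul_le_mul_of_nonneg_left hz2 (sq_nonneg c)
  have hcc : c ^ 2 * (1 / c * ‖ι w‖ ^ 2) = c * ‖ι w‖ ^ 2 := by field_simp
  linarith

/-- Fredholm alternative for symmetric compact perturbations of the identity. -/
theorem isUnit_one_sub_of_injective [CompleteSpace H] {K : H →L[ℝ] H} (hK : IsCompactOperator K)
    (hinj : ∀ u, (1 - K) u = 0 → u = 0) : IsUnit (1 - K) := by
  rcases hK.hasEigenvalue_or_mem_resolventSet (one_ne_zero (α := ℝ)) with h | h
  · obtain ⟨u, hu⟩ := h.exists_hasEigenvector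
    refine absurd (hinj u ?_) hu.2
    have : K u = (1 : ℝ) • u := hu.apply_eq_smul
    simp [this]
  · simpa [spectrum.mem_resolventSet_iff] using h

end SpectralTheory

end Helmholtz

/-! ### Interior cone condition for Lipschitz domains -/

namespace Helmholtz

variable {n : ℕ}

/-- Near `x`, the set `Ω` contains the truncated cone `⋃ₜ ball (y + t e) (c t)` at each of its
points `y`. -/
structure LocalCone (Ω : Set (E n)) (x : E n) (e : E n) (r c t₀ : ℝ) : Prop where
  norm_le : ‖e‖ ≤ 1
  r_pos : 0 < r
  c_pos : 0 < c
  c_le : c ≤ 1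
  t_pos : 0 < t₀
  ball_subset : ∀ y ∈ Ω, y ∈ Metric.ball x r → ∀ t, 0 < t → t < t₀ →
    Metric.ball (y + t • e) (c * t) ⊆ Ω

theorem norm_sub_inner_smul_le {e : E n} (he : ‖e‖ = 1) (d : E n) :
    ‖d - inner ℝ e d • e‖ ≤ 2 * ‖d‖ := by
  have h : ‖inner ℝ e d • e‖ ≤ ‖d‖ := by
    rw [norm_smul, he, mul_one]
    simpa [he] using norm_inner_le_norm (𝕜 := ℝ) e d
  linarith [norm_sub_le d (inner ℝ e d • e)]

/-- At an interior point the direction `0` serves. At a boundary point, the step `t e + d` raises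
the height by at least `t - ‖d‖`, while the graph below rises by at most `2 K ‖d‖`. So `(1 + 2K) ‖d‖
< t` keeps the point in `Ω`, whence `c = 1 / (1 + 2K)`. -/
theorem IsBoundedLipschitzDomain.exists_localCone {Ω : Set (E n)}
    (hΩ : IsBoundedLipschitzDomain Ω) {x : E n} (hx : x ∈ closure Ω) :
    ∃ e r c t₀, LocalCone Ω x e r c t₀ := by
  by_cases hxΩ : x ∈ Ω
  · obtain ⟨r, hr, hball⟩ := Metric.isOpen_iff.1 hΩ.isOpen x hxΩ
    refine ⟨0, r / 2, 1, r / 2, by simp, by linarith, one_pos, le_rfl, by linarith, ?_⟩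
    intro y _ hyx t _ htr z hz
    apply hball
    rw [Metric.mem_ball] at *
    simp only [smul_zero, add_zero, one_mul] at hz
    linarith [dist_triangle z y x]
  · have hfr : x ∈ frontier Ω := by
      rw [hΩ.isOpen.frontier_eq]; exact ⟨hx, hxΩ⟩
    obtain ⟨e, f, K, r, he, hf, hr, hch⟩ := hΩ.lipschitz_boundary x hfr
    have hK : (0 : ℝ) ≤ K := K.2
    have hc : (0 : ℝ) < 1 / (1 + 2 * K) := by positivity
    have hc1 : 1 / (1 + 2 * (K : ℝ)) ≤ 1 := by
      rw [div_le_one (by positivity)]; linarith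
    -- As `‖t e + d‖ ≤ 2t < r/2`, points within `r/2` of `x` stay in the chart ball of radius `r`.
    refine ⟨e, r / 2, 1 / (1 + 2 * K), r / 4, he.le, by linarith, hc, hc1, by linarith, ?_⟩
    intro y hy hyx t ht htr z hz
    set d := z - (y + t • e) with hd
    have hdn : ‖d‖ < 1 / (1 + 2 * K) * t := by simpa [hd, dist_eq_norm] using hz
    have hzy : z = y + t • e + d := by simp [hd]
    have hdt : ‖d‖ ≤ t := hdn.le.trans (by nlinarith)
    rw [Metric.mem_ball, dist_eq_norm] at hyx
    have hzx : z ∈ Metric.ball x r := by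
      rw [Metric.mem_ball, dist_eq_norm]
      have : z - x = (y - x) + (t • e + d) := by rw [hzy]; abel
      have h1 := norm_add_le (y - x) (t • e + d)
      have h2 := norm_add_le (t • e) d
      rw [norm_smul, he, Real.norm_of_nonneg ht.le] at h2
      rw [this]; linarith
    have hyr : y ∈ Metric.ball x r := by
      rw [Metric.mem_ball, dist_eq_norm]; linarith
    have hFy := (hch y hyr).1 hy
    refine (hch z hzx).2 ?_
    have hee : inner ℝ e e = (1 : ℝ) := by rw [real_inner_self_eq_norm_sq, he]; norm_num
    have hez : inner ℝ e z = inner ℝ e y + t + inner ℝ e d := by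
      rw [hzy, inner_add_right, inner_add_right, inner_smul_right, hee, mul_one]
    have hPz : z - inner ℝ e z • e = (y - inner ℝ e y • e) + (d - inner ℝ e d • e) := by
      rw [hez, hzy, add_smul, add_smul]; abel
    have hlip := hf.dist_le_mul (z - inner ℝ e z • e) (y - inner ℝ e y • e)
    rw [Real.dist_eq, dist_eq_norm] at hlip
    have h3 : ‖(z - inner ℝ e z • e) - (y - inner ℝ e y • e)‖ ≤ 2 * ‖d‖ := by
      rw [hPz, add_sub_cancel_left]; exact norm_sub_inner_smul_le he d
    have h4 := (le_abs_self _).trans (hlip.trans (mul_le_mul_of_nonneg_left h3 hK))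
    have h5 : -‖d‖ ≤ inner ℝ e d := by
      have := abs_real_inner_le_norm e d
      rw [he, one_mul] at this
      exact (abs_le.1 this).1
    have h6 : (1 + 2 * K) * ‖d‖ < t := by
      rw [one_div, inv_mul_eq_div, lt_div_iff₀ (by positivity)] at hdn
      linarith
    rw [hez] at *
    nlinarith

/-- A finite cover of `closure Ω` by balls on which `Ω` satisfies the cone condition. -/
theorem IsBoundedLipschitzDomain.exists_finite_cover {Ω : Set (E n)}
    (hΩ : IsBoundedLipschitzDomain Ω) {p : E n → ℝ → Prop}
    (hp : ∀ x ∈ closure Ω, ∃ r > 0, p x r) :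
    ∃ (s : Finset (E n)) (r : E n → ℝ), (∀ x ∈ s, 0 < r x ∧ p x (r x)) ∧
      closure Ω ⊆ ⋃ x ∈ s, Metric.ball x (r x) := by
  choose! r hr hpr using hp
  have hK : IsCompact (closure Ω) := hΩ.isBounded.isCompact_closure
  obtain ⟨s, hs, hcov⟩ := hK.elim_nhds_subcover (fun x => Metric.ball x (r x))
    fun x hx => Metric.ball_mem_nhds x (hr x hx)
  exact ⟨s, r, fun x hx => ⟨hr x (hs x hx), hpr x (hs x hx)⟩, hcov⟩

end Helmholtz

namespace Helmholtz

/-! ### Square-integral inequalities and mollification in `L²` -/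

section Lintegral

variable {α : Type*} [MeasurableSpace α] {μ : Measure α}

theorem sq_lintegral_le {f : α → ℝ≥0∞} (hf : AEMeasurable f μ) :
    (∫⁻ x, f x ∂μ) ^ 2 ≤ μ Set.univ * ∫⁻ x, f x ^ 2 ∂μ := by
  have h := ENNReal.lintegral_mul_le_Lp_mul_Lq μ Real.HolderConjugate.two_two
    (aemeasurable_const (b := (1 : ℝ≥0∞))) hf
  simp only [Pi.mul_apply, one_mul, lintegral_const, ENNReal.rpow_two, one_pow] at h
  calc (∫⁻ x, f x ∂μ) ^ 2
      ≤ (μ Set.univ ^ (1 / 2 : ℝ) * (∫⁻ x, f x ^ 2 ∂μ) ^ (1 / 2 : ℝ)) ^ 2 := by gcongr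
    _ = _ := by
      rw [mul_pow, ← ENNReal.rpow_two, ← ENNReal.rpow_mul, ← ENNReal.rpow_two, ← ENNReal.rpow_mul]
      norm_num

/-- Jensen's inequality for a subprobability density: Cauchy–Schwarz with respect to the measure of
density `ρ`. -/
theorem sq_lintegral_mul_le {f ρ : α → ℝ≥0∞} (hρ : Measurable ρ) (hf : Measurable f)
    (h1 : ∫⁻ x, ρ x ∂μ ≤ 1) :
    (∫⁻ x, ρ x * f x ∂μ) ^ 2 ≤ ∫⁻ x, ρ x * f x ^ 2 ∂μ := by
  have h := sq_lintegral_le (μ := μ.withDensity ρ) (f := f) hf.aemeasurable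
  rw [lintegral_withDensity_eq_lintegral_mul _ hρ hf,
    lintegral_withDensity_eq_lintegral_mul _ hρ (hf.pow_const 2), withDensity_apply _ .univ,
    Measure.restrict_univ] at h
  exact h.trans (mul_le_of_le_one_left' h1)

theorem eLpNorm_two_sq {F : Type*} [NormedAddCommGroup F] (f : α → F) :
    eLpNorm f 2 μ ^ 2 = ∫⁻ x, ‖f x‖ₑ ^ 2 ∂μ := by
  rw [eLpNorm_eq_lintegral_rpow_enorm_toReal (by norm_num) (by norm_num), ← ENNReal.rpow_two,
    ← ENNReal.rpow_mul]
  norm_num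

theorem add_sq_le (a b : ℝ≥0∞) : (a + b) ^ 2 ≤ 2 * a ^ 2 + 2 * b ^ 2 := by
  have h := ENNReal.rpow_add_le_mul_rpow_add_rpow a b (p := 2) (by norm_num)
  norm_num at h
  rwa [mul_add] at h

end Lintegral

section Mollification

variable {n : ℕ} {F : Type*} [NormedAddCommGroup F]

/-- Translation is continuous on `L²(ℝⁿ)`. -/
theorem tendsto_eLpNorm_translate_sub {f : E n → F} (hf : MemLp f 2 volume) :
    Tendsto (fun z => eLpNorm (fun y => f (y - z) - f y) 2 volume) (𝓝 0) (𝓝 0) := by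
  let g : C(E n, C(E n, E n)) :=
    (ContinuousMap.mk (fun a : E n × E n => a.2 - a.1) (by fun_prop)).curry
  have hg : ∀ z, MeasurePreserving (g z) volume volume := fun z =>
    measurePreserving_sub_right volume z
  have h0 : Continuous fun z => Lp.compMeasurePreserving (g z) (hg z) (hf.toLp f) :=
    continuous_const.compMeasurePreservingLp g.continuous hg (by norm_num)
  have h1 := (h0.tendsto 0).edist (tendsto_const_nhds (x := hf.toLp f))
  have h2 : Lp.compMeasurePreserving (g 0) (hg 0) (hf.toLp f) = hf.toLp f := by
    refine Lp.ext ((Lp.coeFn_compMeasurePreserving _ _).trans ?_)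
    exact Eventually.of_forall fun y => by simp [g]
  rw [h2, edist_self] at h1
  refine h1.congr fun z => ?_
  rw [Lp.edist_def]
  refine eLpNorm_congr_ae ?_
  have h3 := (hg z).quasiMeasurePreserving.ae_eq_comp hf.coeFn_toLp
  filter_upwards [Lp.coeFn_compMeasurePreserving (hf.toLp f) (hg z), h3, hf.coeFn_toLp]
    with y hy1 hy2 hy3
  simp only [Pi.sub_apply, hy1, hy2, hy3]
  rfl

/-- Mollification converges in `L²`, uniformly over all mollifiers supported near the origin. -/
theorem exists_eLpNorm_convolution_sub_le [NormedSpace ℝ F] [CompleteSpace F] {f : E n → F}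
    (hfm : StronglyMeasurable f) (hf : MemLp f 2 volume) {ε : ℝ≥0∞} (hε : 0 < ε) :
    ∃ δ > 0, ∀ ρ : E n → ℝ, Continuous ρ → HasCompactSupport ρ → (∀ x, 0 ≤ ρ x) →
      ∫ x, ρ x = 1 → Function.support ρ ⊆ Metric.ball 0 δ →
      eLpNorm (fun y => convolution ρ f (ContinuousLinearMap.lsmul ℝ ℝ) volume y - f y) 2 volume
        ≤ ε := by
  have hev := (tendsto_eLpNorm_translate_sub hf).eventually (eventually_le_nhds hε)
  obtain ⟨δ, hδ, hball⟩ := Metric.eventually_nhds_iff_ball.1 hev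
  refine ⟨δ, hδ, fun ρ hρ hρc hρ0 hρ1 hρs => ?_⟩
  have hρi : Integrable ρ := hρ.integrable_of_hasCompactSupport hρc
  have hρl : ∫⁻ z, ‖ρ z‖ₑ = 1 := by
    have := ofReal_integral_eq_lintegral_ofReal hρi (Eventually.of_forall hρ0)
    rw [hρ1, ENNReal.ofReal_one] at this
    rw [this]
    exact lintegral_congr fun z => (Real.enorm_eq_ofReal (hρ0 z))
  have hloc : LocallyIntegrable f volume :=
    hf.locallyIntegrable (by norm_num)
  have hpt : ∀ y, ‖convolution ρ f (ContinuousLinearMap.lsmul ℝ ℝ) volume y - f y‖ₑ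
      ≤ ∫⁻ z, ‖ρ z‖ₑ * ‖f (y - z) - f y‖ₑ := by
    intro y
    have hex : ConvolutionExistsAt ρ f y (ContinuousLinearMap.lsmul ℝ ℝ) volume :=
      hρc.convolutionExists_left _ hρ hloc y
    have hi1 : Integrable (fun z => ρ z • f (y - z)) := hex
    have hi2 : Integrable (fun z => ρ z • f y) := hρi.smul_const _
    have : convolution ρ f (ContinuousLinearMap.lsmul ℝ ℝ) volume y - f y
        = ∫ z, ρ z • (f (y - z) - f y) := by
      simp_rw [smul_sub]
      rw [integral_sub hi1 hi2, integral_smul_const, hρ1, one_smul]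
      rfl
    rw [this]
    refine (enorm_integral_le_lintegral_enorm _).trans_eq ?_
    simp_rw [enorm_smul]
  have hmeas : Measurable fun p : E n × E n => ‖f (p.1 - p.2) - f p.1‖ₑ :=
    ((hfm.comp_measurable (measurable_fst.sub measurable_snd)).sub
      (hfm.comp_measurable measurable_fst)).enorm
  have hρm : Measurable fun z => ‖ρ z‖ₑ := hρ.measurable.enorm
  -- By Jensen and Tonelli the squared error is at most the `ρ`-average of the squared `L²`
  -- distances between `f` and its translates, so only the support of `ρ` matters for `δ`.
  rw [← ENNReal.pow_le_pow_left_iff two_ne_zero, eLpNorm_two_sq]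
  calc ∫⁻ y, ‖convolution ρ f (ContinuousLinearMap.lsmul ℝ ℝ) volume y - f y‖ₑ ^ 2
      ≤ ∫⁻ y, ∫⁻ z, ‖ρ z‖ₑ * ‖f (y - z) - f y‖ₑ ^ 2 := by
        refine lintegral_mono fun y => (pow_le_pow_left' (hpt y) 2).trans ?_
        exact sq_lintegral_mul_le hρm (hmeas.comp measurable_prodMk_left) hρl.le
    _ = ∫⁻ z, ∫⁻ y, ‖ρ z‖ₑ * ‖f (y - z) - f y‖ₑ ^ 2 := by
        refine lintegral_lintegral_swap ?_
        exact ((hρm.comp measurable_snd).mul (hmeas.pow_const 2)).aemeasurable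
    _ = ∫⁻ z, ‖ρ z‖ₑ * eLpNorm (fun y => f (y - z) - f y) 2 volume ^ 2 := by
        refine lintegral_congr fun z => ?_
        rw [eLpNorm_two_sq, lintegral_const_mul' _ _ enorm_ne_top]
    _ ≤ ∫⁻ z, ‖ρ z‖ₑ * ε ^ 2 := by
        refine lintegral_mono fun z => ?_
        by_cases hz : ρ z = 0
        · simp [hz]
        · have := hball z (hρs hz)
          gcongr
    _ = ε ^ 2 := by rw [lintegral_mul_const _ hρm, hρl, one_mul]

end Mollification

end Helmholtz

namespace Helmholtz

/-! ### Density of smooth functions in `H¹(Ω)` -/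

section Density

variable {n : ℕ} {Ω : Set (E n)}

theorem memLp_indicator_smul {F : Type*} [NormedAddCommGroup F] [NormedSpace ℝ F]
    (hΩ : MeasurableSet Ω) {χ : E n → ℝ} (hχ : Continuous χ) (hc : HasCompactSupport χ)
    (w : Lp F 2 (volume.restrict Ω)) :
    MemLp (Ω.indicator fun x => χ x • w x) 2 volume := by
  rw [memLp_indicator_iff_restrict hΩ]
  exact (Lp.memLp w).smul (p := ∞) (hχ.memLp_of_hasCompactSupport hc)

theorem memLp_indicator_smul_gradient (hΩ : MeasurableSet Ω) {χ : E n → ℝ} (hχ : ContDiff ℝ ∞ χ)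
    (hc : HasCompactSupport χ) (u : L2 Ω) :
    MemLp (Ω.indicator fun x => u x • gradient χ x) 2 volume := by
  rw [memLp_indicator_iff_restrict hΩ]
  have hg : Continuous (gradient χ) :=
    (InnerProductSpace.toDual ℝ (E n)).symm.continuous.comp (hχ.continuous_fderiv (by simp))
  have hgc : HasCompactSupport (gradient χ) :=
    (hc.fderiv ℝ).comp_left (map_zero (InnerProductSpace.toDual ℝ (E n)).symm)
  exact (hg.memLp_of_hasCompactSupport (p := ∞) hgc).smul (p := 2) (Lp.memLp u)

theorem memLp_indicator_product_gradient (hΩ : MeasurableSet Ω) {χ : E n → ℝ}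
    (hχ : ContDiff ℝ ∞ χ) (hc : HasCompactSupport χ) (u : H1 Ω) :
    MemLp (Ω.indicator fun x => χ x • grad u x + val u x • gradient χ x) 2 volume := by
  rw [Set.indicator_add]
  exact (memLp_indicator_smul hΩ hχ.continuous hc (grad u)).add
    (memLp_indicator_smul_gradient hΩ hχ hc (val u))

/-- A smooth mollifier supported in a small ball around `-t e`. -/
theorem exists_offcentre_mollifier (v : E n) {s : ℝ} (hs : 0 < s) :
    ∃ ρ : E n → ℝ, ContDiff ℝ ∞ ρ ∧ HasCompactSupport ρ ∧ (∀ x, 0 ≤ ρ x) ∧ ∫ x, ρ x = 1 ∧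
      ∀ z ∈ tsupport ρ, ‖z + v‖ < s := by
  -- The outer radius `s / 2` keeps the closed support strictly inside the ball of radius `s`.
  let b : ContDiffBump (-v) := ⟨s / 4, s / 2, by linarith, by linarith⟩
  refine ⟨b.normed volume, b.contDiff_normed, b.hasCompactSupport_normed, b.nonneg_normed,
    b.integral_normed, fun z hz => ?_⟩
  rw [b.tsupport_normed_eq, Metric.mem_closedBall, dist_eq_norm, sub_neg_eq_add] at hz
  have : b.rOut = s / 2 := rfl
  linarith

/-- The gradient of a mollification of `χ u` at points where the kernel only sees `Ω`. -/
theorem gradient_convolution (hΩ : MeasurableSet Ω) (u : H1 Ω) {χ ρ : E n → ℝ}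
    (hχ : ContDiff ℝ ∞ χ) (hχc : HasCompactSupport χ) (hρ : ContDiff ℝ ∞ ρ)
    (hρc : HasCompactSupport ρ) {y : E n}
    (hy : ∀ x, x ∈ tsupport χ → y - x ∈ tsupport ρ → x ∈ Ω) :
    gradient (convolution ρ (Ω.indicator fun x => χ x • val u x)
        (ContinuousLinearMap.lsmul ℝ ℝ) volume) y
      = convolution ρ (Ω.indicator fun x => χ x • grad u x + val u x • gradient χ x)
        (ContinuousLinearMap.lsmul ℝ ℝ) volume y := by
  set f := Ω.indicator fun x => χ x • val u x with hf
  set g := Ω.indicator fun x => χ x • grad u x + val u x • gradient χ x with hg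
  have hfL : MemLp f 2 volume := memLp_indicator_smul hΩ hχ.continuous hχc (val u)
  have hgL : MemLp g 2 volume := memLp_indicator_product_gradient hΩ hχ hχc u
  have hfl : LocallyIntegrable f volume := hfL.locallyIntegrable (by norm_num)
  have hgl : LocallyIntegrable g volume := hgL.locallyIntegrable (by norm_num)
  have hder := hρc.hasFDerivAt_convolution_left (ContinuousLinearMap.lsmul ℝ ℝ)
    (hρ.of_le (by simp)) hfl y
  have hρ' : Continuous (fderiv ℝ ρ) := hρ.continuous_fderiv (by simp)
  -- Paired with `e`, both sides become integrals over `Ω`. They agree by the weak gradient identity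
  -- for `x ↦ ρ (y - x) χ x`, whose support lies in `Ω` by `hy`.
  refine ext_inner_right ℝ fun e => ?_
  have hlhs : inner ℝ (gradient (convolution ρ f (ContinuousLinearMap.lsmul ℝ ℝ) volume) y) e
      = ∫ x in Ω, val u x * (fderiv ℝ ρ (y - x) e * χ x) := by
    rw [gradient, InnerProductSpace.toDual_symm_apply, hder.fderiv, convolution_eq_swap,
      ContinuousLinearMap.integral_apply]
    · rw [← integral_indicator hΩ]
      refine integral_congr_ae (Eventually.of_forall fun x => ?_)
      by_cases hx : x ∈ Ω
      · simp [hf, hx]; ring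
      · simp [hf, hx]
    · have := (hρc.fderiv ℝ).convolutionExists_left
        ((ContinuousLinearMap.lsmul ℝ ℝ).precompL (E n)) hρ' hfl y
      exact this.integrable_swap
  have hrhs : inner ℝ (convolution ρ g (ContinuousLinearMap.lsmul ℝ ℝ) volume y) e
      = ∫ x in Ω, (inner ℝ (grad u x) e * (ρ (y - x) * χ x)
          + val u x * (ρ (y - x) * fderiv ℝ χ x e)) := by
    rw [convolution_eq_swap, real_inner_comm, ← integral_inner, ← integral_indicator hΩ]
    · refine integral_congr_ae (Eventually.of_forall fun x => ?_)
      by_cases hx : x ∈ Ω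
      · have h1 : inner ℝ e (gradient χ x) = fderiv ℝ χ x e := by
          rw [real_inner_comm, gradient, InnerProductSpace.toDual_symm_apply]
        simp only [hg, Set.indicator_of_mem hx, ContinuousLinearMap.lsmul_apply,
          inner_smul_right, inner_add_right, h1, real_inner_comm (grad u x) e]
        ring
      · simp [hg, hx]
    · have := hρc.convolutionExists_left (ContinuousLinearMap.lsmul ℝ ℝ) hρ.continuous hgl y
      exact this.integrable_swap
  -- the test function
  let ψ : E n → ℝ := fun x => ρ (y - x) * χ x
  have hρy : ContDiff ℝ ∞ fun x => ρ (y - x) := hρ.comp (contDiff_const.sub contDiff_id)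
  have hψ : ContDiff ℝ ∞ ψ := hρy.mul hχ
  have hψc : HasCompactSupport ψ := hχc.mul_left
  have hψs : tsupport ψ ⊆ Ω := by
    intro x hx
    refine hy x (tsupport_mul_subset_right hx) ?_
    have h1 : x ∈ tsupport fun x => ρ (y - x) := tsupport_mul_subset_left hx
    exact tsupport_comp_subset_preimage ρ (by fun_prop : Continuous fun x => y - x) h1
  have hψd : ∀ x, fderiv ℝ ψ x e = ρ (y - x) * fderiv ℝ χ x e - fderiv ℝ ρ (y - x) e * χ x := by
    intro x
    have h1 : HasFDerivAt (fun x => ρ (y - x)) (-(fderiv ℝ ρ (y - x))) x := by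
      have h2 : HasFDerivAt ρ (fderiv ℝ ρ (y - x)) (y - x) :=
        (hρ.differentiable (by simp) _).hasFDerivAt
      have h3 : HasFDerivAt (fun x : E n => y - x) (-(ContinuousLinearMap.id ℝ (E n))) x :=
        (hasFDerivAt_id x).const_sub y
      exact (h2.comp x h3).congr_fderiv (by ext; simp)
    have h4 : HasFDerivAt χ (fderiv ℝ χ x) x := (hχ.differentiable (by simp) x).hasFDerivAt
    have h5 : HasFDerivAt ψ _ x := h1.mul h4
    rw [h5.fderiv]
    simp
    ring
  have hweak := u.2 ψ hψ hψc hψs e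
  have hi1 : Integrable (fun x => val u x * (fderiv ℝ ρ (y - x) e * χ x)) (volume.restrict Ω) :=
    integrable_mul_test (val u)
      (((hρ'.comp (by fun_prop : Continuous fun x => y - x)).clm_apply continuous_const).mul
        hχ.continuous) hχc.mul_left
  have hi2 : Integrable (fun x => val u x * (ρ (y - x) * fderiv ℝ χ x e)) (volume.restrict Ω) :=
    integrable_mul_test (val u)
      (hρy.continuous.mul ((hχ.continuous_fderiv (by simp)).clm_apply continuous_const))
      (hχc.fderiv_apply ℝ e).mul_left
  have hi3 : Integrable (fun x => inner ℝ (grad u x) e * (ρ (y - x) * χ x)) (volume.restrict Ω) :=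
    integrable_inner_mul_test (grad u) e hψ.continuous hψc
  rw [hlhs, hrhs, integral_add hi3 hi2]
  have h5 : ∫ x in Ω, val u x * fderiv ℝ ψ x e
      = (∫ x in Ω, val u x * (ρ (y - x) * fderiv ℝ χ x e))
        - ∫ x in Ω, val u x * (fderiv ℝ ρ (y - x) e * χ x) := by
    rw [← integral_sub hi2 hi1]
    refine integral_congr_ae (Eventually.of_forall fun x => ?_)
    simp only [hψd]; ring
  change ∫ x in Ω, val u x * fderiv ℝ ψ x e = -∫ x in Ω, inner ℝ (grad u x) e * ψ x at hweak
  rw [h5] at hweak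
  linarith

/-- Local approximation of `χ u` by smooth functions. -/
theorem LocalCone.exists_approx {x₀ e : E n} {r c t₀ : ℝ} (hcone : LocalCone Ω x₀ e r c t₀)
    (hΩ : MeasurableSet Ω) (u : H1 Ω) {χ : E n → ℝ} (hχ : ContDiff ℝ ∞ χ)
    (hχs : tsupport χ ⊆ Metric.ball x₀ (r / 2)) {ε : ℝ≥0∞} (hε : 0 < ε) :
    ∃ φ : E n → ℝ, ContDiff ℝ ∞ φ ∧
      eLpNorm (fun x => φ x - χ x * val u x) 2 (volume.restrict Ω) ≤ ε ∧
      eLpNorm (fun x => gradient φ x - (χ x • grad u x + val u x • gradient χ x)) 2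
        (volume.restrict Ω) ≤ ε := by
  have hχc : HasCompactSupport χ := HasCompactSupport.of_support_subset_isCompact
    (isCompact_closedBall x₀ (r / 2))
    ((subset_tsupport χ).trans (hχs.trans Metric.ball_subset_closedBall))
  have hgrad : Continuous (gradient χ) :=
    (InnerProductSpace.toDual ℝ (E n)).symm.continuous.comp (hχ.continuous_fderiv (by simp))
  set f := Ω.indicator fun x => χ x • val u x with hf
  set g := Ω.indicator fun x => χ x • grad u x + val u x • gradient χ x with hg
  have hfL : MemLp f 2 volume := memLp_indicator_smul hΩ hχ.continuous hχc (val u)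
  have hgL : MemLp g 2 volume := memLp_indicator_product_gradient hΩ hχ hχc u
  have hfm : StronglyMeasurable f :=
    (hχ.continuous.stronglyMeasurable.smul (Lp.stronglyMeasurable _)).indicator hΩ
  have hg1 : StronglyMeasurable fun x => χ x • grad u x :=
    hχ.continuous.stronglyMeasurable.smul (Lp.stronglyMeasurable (grad u))
  have hg2 : StronglyMeasurable fun x => val u x • gradient χ x :=
    (Lp.stronglyMeasurable (val u)).smul hgrad.stronglyMeasurable
  have hgm : StronglyMeasurable g := (hg1.add hg2).indicator hΩ
  obtain ⟨δ₁, hδ₁, h1⟩ := exists_eLpNorm_convolution_sub_le hfm hfL hε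
  obtain ⟨δ₂, hδ₂, h2⟩ := exists_eLpNorm_convolution_sub_le hgm hgL hε
  -- The bounds serve three purposes: `t₀` for the cone, `r / 4` because `r / 2 + 2t` must not
  -- exceed `r`, and `δᵢ / 2` because the kernel is supported within distance `2t` of the origin.
  obtain ⟨t, ht, htlt⟩ : ∃ t > 0, t < min (min t₀ (r / 4)) (min (δ₁ / 2) (δ₂ / 2)) := by
    refine ⟨min (min t₀ (r / 4)) (min (δ₁ / 2) (δ₂ / 2)) / 2, ?_, ?_⟩
    · have := hcone.t_pos
      have := hcone.r_pos
      positivity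
    · refine half_lt_self ?_
      have := hcone.t_pos
      have := hcone.r_pos
      positivity
  simp only [lt_min_iff] at htlt
  have hct : 0 < c * t := mul_pos hcone.c_pos ht
  have hctt : c * t ≤ t := mul_le_of_le_one_left ht.le hcone.c_le
  have hte : ‖t • e‖ ≤ t := by
    rw [norm_smul, Real.norm_of_nonneg ht.le]
    exact mul_le_of_le_one_right ht.le hcone.norm_le
  obtain ⟨ρ, hρ, hρc, hρ0, hρ1, hρt⟩ := exists_offcentre_mollifier (t • e) hct
  have hρsub : ∀ z ∈ tsupport ρ, ‖z‖ < 2 * t := by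
    intro z hz
    have : ‖z‖ ≤ ‖z + t • e‖ + ‖t • e‖ := by simpa using norm_sub_le (z + t • e) (t • e)
    linarith [hρt z hz]
  have hρball : ∀ δ, t < δ / 2 → Function.support ρ ⊆ Metric.ball 0 δ := by
    intro δ hδ z hz
    rw [mem_ball_zero_iff]
    linarith [hρsub z (subset_tsupport _ hz)]
  refine ⟨convolution ρ f (ContinuousLinearMap.lsmul ℝ ℝ) volume,
    hρc.contDiff_convolution_left _ hρ (hfL.locallyIntegrable (by norm_num)), ?_, ?_⟩
  · refine le_trans (le_of_eq_of_le ?_ (eLpNorm_mono_measure _ (Measure.restrict_le_self (s := Ω))))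
      (h1 ρ hρ.continuous hρc hρ0 hρ1 (hρball _ htlt.2.1))
    refine eLpNorm_congr_ae ?_
    filter_upwards [ae_restrict_mem hΩ] with y hy
    simp [hf, hy]
  · refine le_trans (le_of_eq_of_le ?_ (eLpNorm_mono_measure _ (Measure.restrict_le_self (s := Ω))))
      (h2 ρ hρ.continuous hρc hρ0 hρ1 (hρball _ htlt.2.2))
    refine eLpNorm_congr_ae ?_
    filter_upwards [ae_restrict_mem hΩ] with y hy
    rw [gradient_convolution hΩ u hχ hχc hρ hρc]
    · simp [hg, hy]
    -- The kernel lives near `-t e`, so at `y` it samples only points `x` of the ball of radius `c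
    -- t` around `y + t e`, which the cone condition places in `Ω`. Cutting `χ u` off by zero
    -- outside `Ω` therefore creates no boundary term.
    · intro x hx hyx
      have hz1 := hρt _ hyx
      have hz2 := hρsub _ hyx
      have hxr := hχs hx
      rw [Metric.mem_ball, dist_eq_norm] at hxr
      have hyr : y ∈ Metric.ball x₀ r := by
        rw [Metric.mem_ball, dist_eq_norm]
        have : ‖y - x₀‖ ≤ ‖y - x‖ + ‖x - x₀‖ := norm_sub_le_norm_sub_add_norm_sub y x x₀
        linarith [htlt.1.2]
      refine hcone.ball_subset y hy hyr t ht htlt.1.1 ?_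
      rw [Metric.mem_ball, dist_comm, dist_eq_norm]
      rwa [add_sub_right_comm]

/-- Smooth functions on `ℝⁿ` are dense in `H¹(Ω)`. -/
theorem IsBoundedLipschitzDomain.exists_smooth_approx (hΩ : IsBoundedLipschitzDomain Ω)
    (u : H1 Ω) {ε : ℝ≥0∞} (hε : 0 < ε) :
    ∃ φ : E n → ℝ, ContDiff ℝ ∞ φ ∧
      eLpNorm (fun x => φ x - val u x) 2 (volume.restrict Ω) ≤ ε ∧
      eLpNorm (fun x => gradient φ x - grad u x) 2 (volume.restrict Ω) ≤ ε := by
  have hm : MeasurableSet Ω := hΩ.isOpen.measurableSet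
  obtain ⟨s, r, hs, hcov⟩ := hΩ.exists_finite_cover
    (p := fun x r => ∃ e c t₀, LocalCone Ω x e (2 * r) c t₀) (by
      intro x hx
      obtain ⟨e, r, c, t₀, h⟩ := hΩ.exists_localCone hx
      exact ⟨r / 2, half_pos h.r_pos, e, c, t₀, by rwa [mul_div_cancel₀ _ two_ne_zero]⟩)
  obtain ⟨P, hP⟩ := SmoothPartitionOfUnity.exists_isSubordinate
    (modelWithCornersSelf ℝ (E n)) (isClosed_closure (s := Ω))
    (fun i : s => Metric.ball (i : E n) (r i)) (fun i => Metric.isOpen_ball) (by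
      intro x hx
      obtain ⟨i, hi, hxi⟩ := Set.mem_iUnion₂.1 (hcov hx)
      exact Set.mem_iUnion.2 ⟨⟨i, hi⟩, hxi⟩)
  have hPs : ∀ i, ContDiff ℝ ∞ (P i) := fun i => (P i).contMDiff.contDiff
  have hsum : ∀ x ∈ Ω, ∑ i, P i x = 1 := by
    intro x hx
    rw [← finsum_eq_sum_of_fintype]
    exact P.sum_eq_one (subset_closure hx)
  -- The partition sums to one on a neighbourhood of `x`, since `Ω` is open. So the terms `u ∇Pᵢ`
  -- from the product rule cancel.
  have hgsum : ∀ x ∈ Ω, ∑ i, gradient (P i) x = 0 := by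
    intro x hx
    have h1 : fderiv ℝ (fun y => ∑ i, P i y) x = 0 := by
      have : (fun y => ∑ i, P i y) =ᶠ[𝓝 x] fun _ => (1 : ℝ) := by
        filter_upwards [hΩ.isOpen.mem_nhds hx] with y hy using hsum y hy
      rw [this.fderiv_eq, fderiv_fun_const]; rfl
    rw [fderiv_fun_sum fun i _ => (hPs i).differentiable (by simp) x] at h1
    simp only [gradient]
    rw [← map_sum, h1, map_zero]
  set N : ℝ≥0∞ := (Fintype.card s : ℝ≥0∞) + 1 with hN
  have hε' : 0 < ε / N := ENNReal.div_pos hε.ne' (by simp [hN])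
  have hloc : ∀ i : s, ∃ φ : E n → ℝ, ContDiff ℝ ∞ φ ∧
      eLpNorm (fun x => φ x - P i x * val u x) 2 (volume.restrict Ω) ≤ ε / N ∧
      eLpNorm (fun x => gradient φ x - (P i x • grad u x + val u x • gradient (P i) x)) 2
        (volume.restrict Ω) ≤ ε / N := by
    intro i
    obtain ⟨-, e, c, t₀, hcone⟩ := hs i i.2
    refine hcone.exists_approx hm u (hPs i) ?_ hε'
    rw [mul_div_cancel_left₀ _ two_ne_zero]
    exact hP i
  choose φ hφ h1 h2 using hloc
  have hbound : ∑ _i : s, ε / N ≤ ε := by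
    rw [Finset.sum_const, Finset.card_univ, nsmul_eq_mul]
    calc (Fintype.card s : ℝ≥0∞) * (ε / N) ≤ N * (ε / N) := by gcongr; simp [hN]
      _ ≤ ε := ENNReal.mul_div_le
  have hgcont : ∀ {φ : E n → ℝ}, ContDiff ℝ ∞ φ → Continuous (gradient φ) := fun h =>
    (InnerProductSpace.toDual ℝ (E n)).symm.continuous.comp (h.continuous_fderiv (by simp))
  refine ⟨fun x => ∑ i, φ i x, ContDiff.sum fun i _ => hφ i, ?_, ?_⟩
  · have : eLpNorm (fun x => ∑ i, φ i x - val u x) 2 (volume.restrict Ω)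
        = eLpNorm (∑ i, fun x => φ i x - P i x * val u x) 2 (volume.restrict Ω) := by
      refine eLpNorm_congr_ae ?_
      filter_upwards [ae_restrict_mem hm] with x hx
      rw [Finset.sum_apply, Finset.sum_sub_distrib, ← Finset.sum_mul, hsum x hx, one_mul]
    rw [this]
    refine (eLpNorm_sum_le (fun i _ => ?_) (by norm_num)).trans
      ((Finset.sum_le_sum fun i _ => h1 i).trans hbound)
    exact (hφ i).continuous.aestronglyMeasurable.sub
      ((hPs i).continuous.aestronglyMeasurable.mul (Lp.aestronglyMeasurable _))
  · have : eLpNorm (fun x => gradient (fun x => ∑ i, φ i x) x - grad u x) 2 (volume.restrict Ω)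
        = eLpNorm (∑ i, fun x => gradient (φ i) x
            - (P i x • grad u x + val u x • gradient (P i) x)) 2 (volume.restrict Ω) := by
      refine eLpNorm_congr_ae ?_
      filter_upwards [ae_restrict_mem hm] with x hx
      have hg : gradient (fun x => ∑ i, φ i x) x = ∑ i, gradient (φ i) x := by
        simp only [gradient]
        rw [fderiv_fun_sum fun i _ => (hφ i).differentiable (by simp) x, map_sum]
      rw [Finset.sum_apply, Finset.sum_sub_distrib, Finset.sum_add_distrib, ← Finset.sum_smul,
        ← Finset.smul_sum, hsum x hx, hgsum x hx, one_smul, smul_zero, add_zero, hg]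
    rw [this]
    refine (eLpNorm_sum_le (fun i _ => ?_) (by norm_num)).trans
      ((Finset.sum_le_sum fun i _ => h2 i).trans hbound)
    exact (hgcont (hφ i)).aestronglyMeasurable.sub
      (((hPs i).continuous.aestronglyMeasurable.smul (Lp.aestronglyMeasurable _)).add
        ((Lp.aestronglyMeasurable (val u)).smul (hgcont (hPs i)).aestronglyMeasurable))

end Density

end Helmholtz

/-! ### Gradient bounds for differences and local averages -/

namespace Helmholtz

variable {n : ℕ} {Ω : Set (E n)}

theorem continuous_gradient {φ : E n → ℝ} (hφ : ContDiff ℝ ∞ φ) : Continuous (gradient φ) :=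
  (InnerProductSpace.toDual ℝ (E n)).symm.continuous.comp (hφ.continuous_fderiv (by simp))

theorem enorm_sub_le_lintegral_gradient {φ : E n → ℝ} (hφ : ContDiff ℝ ∞ φ) (x z : E n) {t : ℝ}
    (ht : 0 ≤ t) :
    ‖φ (x + t • z) - φ x‖ₑ ≤ ∫⁻ s in Set.Icc 0 t, ‖z‖ₑ * ‖gradient φ (x + s • z)‖ₑ := by
  have hline : ContDiff ℝ ∞ fun s : ℝ => x + s • z := by fun_prop
  have h := enorm_sub_le_lintegral_deriv_of_contDiffOn_Icc
    (f := fun s : ℝ => φ (x + s • z)) ((hφ.comp hline).of_le (by simp)).contDiffOn ht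
  simp only [zero_smul, add_zero] at h
  refine h.trans (lintegral_mono fun s => ?_)
  have h1 : HasDerivAt (fun s : ℝ => x + s • z) z s := by
    simpa using ((hasDerivAt_id s).smul_const z).const_add x
  have h2 : HasFDerivAt φ (fderiv ℝ φ (x + s • z)) (x + s • z) :=
    (hφ.differentiable (by simp) _).hasFDerivAt
  have h3 : HasDerivAt (fun s : ℝ => φ (x + s • z)) (fderiv ℝ φ (x + s • z) z) s :=
    h2.comp_hasDerivAt s h1
  have h4 : ‖fderiv ℝ φ (x + s • z)‖ₑ = ‖gradient φ (x + s • z)‖ₑ := by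
    rw [← ofReal_norm, ← ofReal_norm, gradient, LinearIsometryEquiv.norm_map]
  change ‖deriv (fun s : ℝ => φ (x + s • z)) s‖ₑ ≤ _
  rw [h3.deriv, ← h4, mul_comm]
  exact ContinuousLinearMap.le_opENorm _ _

theorem enorm_sub_sq_le_lintegral_gradient {φ : E n → ℝ} (hφ : ContDiff ℝ ∞ φ) (x z : E n) {t : ℝ}
    (ht : 0 ≤ t) :
    ‖φ (x + t • z) - φ x‖ₑ ^ 2
      ≤ ENNReal.ofReal t * (‖z‖ₑ ^ 2 * ∫⁻ s in Set.Icc 0 t, ‖gradient φ (x + s • z)‖ₑ ^ 2) := by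
  have hm : Measurable fun s : ℝ => ‖gradient φ (x + s • z)‖ₑ :=
    ((continuous_gradient hφ).comp (by fun_prop : Continuous fun s : ℝ => x + s • z)).measurable.enorm
  refine (pow_le_pow_left' (enorm_sub_le_lintegral_gradient hφ x z ht) 2).trans ?_
  refine (sq_lintegral_le (hm.const_mul _).aemeasurable).trans_eq ?_
  simp_rw [mul_pow]
  rw [lintegral_const_mul _ (hm.pow_const 2), Measure.restrict_apply .univ, Set.univ_inter,
    Real.volume_Icc, sub_zero]

/-- A smooth function is square integrable on bounded sets. -/
theorem memLp_of_continuous {F : Type*} [NormedAddCommGroup F]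
    (hb : Bornology.IsBounded Ω) (hΩ : MeasurableSet Ω) {f : E n → F}
    (hf : Continuous f) : MemLp f 2 (volume.restrict Ω) := by
  have hK : IsCompact (closure Ω) := hb.isCompact_closure
  obtain ⟨C, hC⟩ := hK.exists_bound_of_continuousOn hf.continuousOn
  have : IsFiniteMeasure (volume.restrict Ω) := ⟨by
    rw [Measure.restrict_apply_univ]; exact hb.measure_lt_top⟩
  refine MemLp.of_bound hf.aestronglyMeasurable C ?_
  filter_upwards [ae_restrict_mem hΩ] with x hx using hC x (subset_closure hx)

/-- The cone condition with constants that do not depend on the point. -/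
theorem IsBoundedLipschitzDomain.exists_uniform_cone (hΩ : IsBoundedLipschitzDomain Ω) :
    ∃ c > 0, ∃ t₀ > 0, ∃ δ > 0, c ≤ 1 ∧ ∀ y₀ ∈ Ω, ∃ e : E n, ‖e‖ ≤ 1 ∧
      ∀ y ∈ Ω, y ∈ Metric.ball y₀ δ → ∀ t, 0 < t → t < t₀ → Metric.ball (y + t • e) (c * t) ⊆ Ω := by
  obtain ⟨s, r, hs, hcov⟩ := hΩ.exists_finite_cover
    (p := fun x r => ∃ e c t₀, LocalCone Ω x e (2 * r) c t₀) (by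
      intro x hx
      obtain ⟨e, r, c, t₀, h⟩ := hΩ.exists_localCone hx
      exact ⟨r / 2, half_pos h.r_pos, e, c, t₀, by rwa [mul_div_cancel₀ _ two_ne_zero]⟩)
  have hs1 : ∀ x ∈ s, ∃ e c t₀, LocalCone Ω x e (2 * r x) c t₀ := fun x hx => (hs x hx).2
  choose! e c t₀ hcone using hs1
  have hne : s.Nonempty := by
    obtain ⟨x, hx⟩ := hΩ.isConnected.nonempty
    obtain ⟨i, hi, -⟩ := Set.mem_iUnion₂.1 (hcov (subset_closure hx))
    exact ⟨i, hi⟩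
  refine ⟨s.inf' hne c, (Finset.lt_inf'_iff _).2 fun x hx => (hcone x hx).c_pos,
    s.inf' hne t₀, (Finset.lt_inf'_iff _).2 fun x hx => (hcone x hx).t_pos,
    s.inf' hne r, (Finset.lt_inf'_iff _).2 fun x hx => (hs x hx).1, ?_, fun y₀ hy₀ => ?_⟩
  · obtain ⟨x, hx⟩ := hne
    exact (Finset.inf'_le _ hx).trans (hcone x hx).c_le
  · obtain ⟨i, hi, hyi⟩ := Set.mem_iUnion₂.1 (hcov (subset_closure hy₀))
    refine ⟨e i, (hcone i hi).norm_le, fun y hy hyy t ht htt => ?_⟩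
    refine (Metric.ball_subset_ball ?_).trans ((hcone i hi).ball_subset y hy ?_ t ht ?_)
    · exact mul_le_mul_of_nonneg_right (Finset.inf'_le _ hi) ht.le
    -- The balls of radius `r i` cover while the cone condition holds on those of radius `2 r i`,
    -- which leaves room for `δ`, the minimum of the `r i`.
    · rw [Metric.mem_ball] at *
      have := Finset.inf'_le r hi
      linarith [dist_triangle y y₀ i]
    · exact htt.trans_le (Finset.inf'_le _ hi)

/-- Jensen: the deviation of `a` from the mean is the mean of the deviations. -/
theorem sq_enorm_sub_average_le {B : Set (E n)} (hB0 : volume B ≠ 0) (hB : volume B ≠ ⊤)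
    {φ : E n → ℝ} (hφ : Continuous φ) (hi : IntegrableOn φ B) (a : ℝ) :
    ‖a - (volume.real B)⁻¹ * ∫ x in B, φ x‖ₑ ^ 2
      ≤ (volume B)⁻¹ * ∫⁻ x in B, ‖φ x - a‖ₑ ^ 2 := by
  have hreal : volume.real B ≠ 0 := (measureReal_ne_zero_iff hB).2 hB0
  have h1 : a - (volume.real B)⁻¹ * ∫ x in B, φ x = -((volume.real B)⁻¹ * ∫ x in B, (φ x - a)) := by
    rw [integral_sub hi (integrableOn_const hB), setIntegral_const, smul_eq_mul]
    field_simp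
    ring
  have hm : Measurable fun x => ‖φ x - a‖ₑ := (hφ.sub continuous_const).measurable.enorm
  have h2 : ‖a - (volume.real B)⁻¹ * ∫ x in B, φ x‖ₑ
      ≤ (volume B)⁻¹ * ∫⁻ x in B, ‖φ x - a‖ₑ := by
    rw [h1, enorm_neg, enorm_mul]
    refine mul_le_mul' (le_of_eq ?_) (enorm_integral_le_lintegral_enorm _)
    rw [Real.enorm_eq_ofReal (by positivity), ENNReal.ofReal_inv_of_pos
      (lt_of_le_of_ne measureReal_nonneg hreal.symm), ofReal_measureReal hB]
  refine (pow_le_pow_left' h2 2).trans ?_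
  rw [mul_pow]
  have h3 := sq_lintegral_le (μ := volume.restrict B) hm.aemeasurable
  rw [Measure.restrict_apply_univ] at h3
  calc (volume B)⁻¹ ^ 2 * (∫⁻ x in B, ‖φ x - a‖ₑ) ^ 2
      ≤ (volume B)⁻¹ ^ 2 * (volume B * ∫⁻ x in B, ‖φ x - a‖ₑ ^ 2) := by gcongr
    _ = (volume B)⁻¹ * ((volume B)⁻¹ * volume B) * ∫⁻ x in B, ‖φ x - a‖ₑ ^ 2 := by ring
    _ = _ := by rw [ENNReal.inv_mul_cancel hB0 hB, mul_one]

/-- Averaging over a nearby ball, in terms of the gradient. -/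
theorem sq_enorm_sub_average_le_gradient (hΩ : MeasurableSet Ω) {φ : E n → ℝ}
    (hφ : ContDiff ℝ ∞ φ) {y p : E n} {s d : ℝ} (hs : 0 < s)
    (hd : ∀ x ∈ Metric.ball p s, ‖x - y‖ < d)
    (hseg : ∀ x ∈ Metric.ball p s, ∀ l ∈ Set.Icc (0 : ℝ) 1, y + l • (x - y) ∈ Ω) :
    ‖φ y - (volume.real (Metric.ball p s))⁻¹ * ∫ x in Metric.ball p s, φ x‖ₑ ^ 2
      ≤ (volume (Metric.ball p s))⁻¹ * (ENNReal.ofReal d ^ 2 *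
        ∫⁻ z in Metric.ball 0 d, ∫⁻ l in Set.Icc (0 : ℝ) 1,
          Ω.indicator (fun x => ‖gradient φ x‖ₑ ^ 2) (y + l • z)) := by
  have hb0 : volume (Metric.ball p s) ≠ 0 := (Metric.measure_ball_pos _ _ hs).ne'
  have hbt : volume (Metric.ball p s) ≠ ⊤ := measure_ball_lt_top.ne
  have hi : IntegrableOn φ (Metric.ball p s) :=
    (hφ.continuous.continuousOn.integrableOn_compact (isCompact_closedBall p s)).mono_set
      Metric.ball_subset_closedBall
  refine (sq_enorm_sub_average_le hb0 hbt hφ.continuous hi (φ y)).trans ?_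
  gcongr
  set h : E n → ℝ≥0∞ := Ω.indicator (fun x => ‖gradient φ x‖ₑ ^ 2) with hh
  have hhm : Measurable h := ((continuous_gradient hφ).measurable.enorm.pow_const 2).indicator hΩ
  have hjm : Measurable fun p : E n × ℝ => h (y + p.2 • p.1) :=
    hhm.comp (by fun_prop)
  have hHm : Measurable fun z => ∫⁻ l in Set.Icc (0 : ℝ) 1, h (y + l • z) :=
    hjm.lintegral_prod_right'
  -- Substituting `z = x - y` moves the domain of integration to a ball about the origin that no
  -- longer depends on `y`. The indicator of `Ω` lets `y` later range over all of space.
  calc ∫⁻ x in Metric.ball p s, ‖φ x - φ y‖ₑ ^ 2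
      ≤ ∫⁻ x in Metric.ball p s, (Metric.ball (0 : E n) d).indicator (fun z =>
          ENNReal.ofReal d ^ 2 * ∫⁻ l in Set.Icc (0 : ℝ) 1, h (y + l • z)) (x - y) := by
        refine setLIntegral_mono' Metric.isOpen_ball.measurableSet fun x hx => ?_
        have hxd := hd x hx
        rw [Set.indicator_of_mem (by simpa using hxd)]
        have h1 := enorm_sub_sq_le_lintegral_gradient hφ y (x - y) zero_le_one
        simp only [one_smul, add_sub_cancel, ENNReal.ofReal_one, one_mul] at h1
        refine h1.trans (mul_le_mul' ?_ ?_)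
        · gcongr
          rw [← ofReal_norm]
          exact ENNReal.ofReal_le_ofReal hxd.le
        · refine setLIntegral_mono' measurableSet_Icc fun l hl => ?_
          rw [hh, Set.indicator_of_mem (hseg x hx l hl)]
    _ ≤ ∫⁻ x, (Metric.ball (0 : E n) d).indicator (fun z =>
          ENNReal.ofReal d ^ 2 * ∫⁻ l in Set.Icc (0 : ℝ) 1, h (y + l • z)) (x - y) :=
        setLIntegral_le_lintegral _ _
    _ = ENNReal.ofReal d ^ 2 *
        ∫⁻ z in Metric.ball 0 d, ∫⁻ l in Set.Icc (0 : ℝ) 1, h (y + l • z) := by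
        rw [lintegral_sub_right_eq_self (fun z => (Metric.ball (0 : E n) d).indicator (fun z =>
          ENNReal.ofReal d ^ 2 * ∫⁻ l in Set.Icc (0 : ℝ) 1, h (y + l • z)) z) y,
          lintegral_indicator Metric.isOpen_ball.measurableSet, lintegral_const_mul _ hHm]

/-- For fixed `z` and `l` the integral over `y` is translation invariant, so each `(z, l)`
contributes the same amount. -/
theorem lintegral_translates_le (hΩ : MeasurableSet Ω) {φ : E n → ℝ}
    (hφ : ContDiff ℝ ∞ φ) (d : ℝ) :
    ∫⁻ y, ∫⁻ z in Metric.ball 0 d, ∫⁻ l in Set.Icc (0 : ℝ) 1,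
          Ω.indicator (fun x => ‖gradient φ x‖ₑ ^ 2) (y + l • z)
      = volume (Metric.ball (0 : E n) d) * eLpNorm (gradient φ) 2 (volume.restrict Ω) ^ 2 := by
  set h : E n → ℝ≥0∞ := Ω.indicator (fun x => ‖gradient φ x‖ₑ ^ 2) with hh
  have hhm : Measurable h := ((continuous_gradient hφ).measurable.enorm.pow_const 2).indicator hΩ
  have hjm : Measurable fun p : (E n × E n) × ℝ => h (p.1.1 + p.2 • p.1.2) :=
    hhm.comp (by fun_prop)
  have hint : ∫⁻ x, h x = eLpNorm (gradient φ) 2 (volume.restrict Ω) ^ 2 := by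
    rw [eLpNorm_two_sq, hh, lintegral_indicator hΩ]
  rw [lintegral_lintegral_swap hjm.lintegral_prod_right'.aemeasurable]
  have h1 : ∀ z : E n, ∫⁻ y, ∫⁻ l in Set.Icc (0 : ℝ) 1, h (y + l • z) = ∫⁻ x, h x := by
    intro z
    have hm2 : Measurable fun p : E n × ℝ => h (p.1 + p.2 • z) := hhm.comp (by fun_prop)
    rw [lintegral_lintegral_swap hm2.aemeasurable]
    simp_rw [lintegral_add_right_eq_self h]
    simp
  simp_rw [h1, hint]
  rw [lintegral_const, Measure.restrict_apply_univ, mul_comm]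

end Helmholtz

/-! ### Rellich's theorem by finite rank averaging -/

namespace Helmholtz

variable {n : ℕ} {Ω : Set (E n)}

theorem isCompactOperator_smulRight {H L : Type*} [NormedAddCommGroup H] [NormedSpace ℝ H]
    [NormedAddCommGroup L] [NormedSpace ℝ L] (f : H →L[ℝ] ℝ) (y : L) :
    IsCompactOperator (f.smulRight y) := by
  have h : IsCompactOperator (ContinuousLinearMap.toSpanSingleton ℝ y) :=
    isCompactOperator_of_locallyCompactSpace_rng _
  exact h.comp_clm f

theorem isCompactOperator_sum {H L ι : Type*} [NormedAddCommGroup H] [NormedSpace ℝ H]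
    [NormedAddCommGroup L] [NormedSpace ℝ L] (s : Finset ι) (R : ι → H →L[ℝ] L)
    (h : ∀ i ∈ s, IsCompactOperator (R i)) : IsCompactOperator (∑ i ∈ s, R i : H →L[ℝ] L) := by
  classical
  induction s using Finset.induction_on with
  | empty => rw [Finset.sum_empty]; exact isCompactOperator_zero
  | insert a s ha ih =>
    rw [Finset.sum_insert ha]
    exact (h a (Finset.mem_insert_self a s)).add
      (ih fun i hi => h i (Finset.mem_insert_of_mem hi))

/-- Finite rank approximation by replacing a function on small pieces `P i` of `Ω` by its averages
over balls `B i`. -/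
theorem exists_averaging {m : ℕ} (hΩb : Bornology.IsBounded Ω)
    (P B : Fin m → Set (E n)) (hP : ∀ i, MeasurableSet (P i)) (hB : ∀ i, MeasurableSet (B i))
    (hdisj : Pairwise (Function.onFun Disjoint P)) (hPΩ : Ω ⊆ ⋃ i, P i)
    (hBΩ : ∀ i, B i ⊆ Ω) :
    ∃ R : L2 Ω →L[ℝ] L2 Ω, IsCompactOperator R ∧ ∀ (φ : E n → ℝ) (v : L2 Ω),
      v =ᵐ[volume.restrict Ω] φ → ∀ᵐ y ∂(volume.restrict Ω), y ∈ Ω → ∃ i, y ∈ P i ∧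
        (v - R v) y = φ y - (volume.real (B i))⁻¹ * ∫ x in B i, φ x := by
  have hfin : IsFiniteMeasure (volume.restrict Ω) := ⟨by
    rw [Measure.restrict_apply_univ]; exact hΩb.measure_lt_top⟩
  let a : Fin m → L2 Ω →L[ℝ] ℝ := fun i => innerSL ℝ
    (indicatorConstLp 2 (hB i) (measure_ne_top _ _) (volume.real (B i))⁻¹ : L2 Ω)
  let p : Fin m → L2 Ω := fun i => indicatorConstLp 2 (hP i) (measure_ne_top _ _) 1
  refine ⟨∑ i, (a i).smulRight (p i),
    isCompactOperator_sum _ _ fun i _ => isCompactOperator_smulRight _ _, fun φ v hv => ?_⟩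
  have ha : ∀ i, a i v = (volume.real (B i))⁻¹ * ∫ x in B i, φ x := by
    intro i
    change inner ℝ (indicatorConstLp 2 (hB i) (measure_ne_top _ _) _ : L2 Ω) v = _
    rw [L2.inner_indicatorConstLp_eq_inner_setIntegral, Measure.restrict_restrict (hB i),
      Set.inter_eq_self_of_subset_left (hBΩ i), RCLike.inner_apply, conj_trivial, mul_comm]
    congr 1
    exact integral_congr_ae (ae_restrict_of_ae_restrict_of_subset (hBΩ i) hv)
  have hR : (∑ i, (a i).smulRight (p i)) v = ∑ i, a i v • p i := by
    simp
  have hp : ∀ᵐ y ∂(volume.restrict Ω), ∀ i, p i y = (P i).indicator (fun _ => (1 : ℝ)) y :=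
    ae_all_iff.2 fun i => indicatorConstLp_coeFn
  have hsm : ∀ᵐ y ∂(volume.restrict Ω), ∀ i, (a i v • p i : L2 Ω) y = a i v * p i y := by
    refine ae_all_iff.2 fun i => ?_
    filter_upwards [Lp.coeFn_smul (a i v) (p i)] with y hy
    rw [hy]; rfl
  rw [hR]
  filter_upwards [hv, hp, hsm, Lp.coeFn_sub v (∑ i, a i v • p i),
    Lp.coeFn_finsetSum Finset.univ fun i => a i v • p i] with y h1 h2 h3 h4 h5 hy
  obtain ⟨i, hi⟩ := Set.mem_iUnion.1 (hPΩ hy)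
  refine ⟨i, hi, ?_⟩
  rw [h4, Pi.sub_apply, h5, Finset.sum_apply, h1, ← ha i, Finset.sum_eq_single i]
  · rw [h3, h2, Set.indicator_of_mem hi, mul_one]
  · intro j _ hj
    have : y ∉ P j := fun hyj => (Set.disjoint_left.1 (hdisj hj)) hyj hi
    rw [h3, h2, Set.indicator_of_notMem this, mul_zero]
  · simp

/-- `R` replaces `v` on each small piece by its mean over a ball pushed into `Ω` along the local
cone. The segments from the piece to that ball stay in `Ω`, so the error is controlled by the
gradient in `Ω` alone, with a factor of order `t`. No extension operator enters. -/
theorem IsBoundedLipschitzDomain.exists_compact_approx (hΩ : IsBoundedLipschitzDomain Ω)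
    {ε : ℝ} (hε : 0 < ε) :
    ∃ R : L2 Ω →L[ℝ] L2 Ω, IsCompactOperator R ∧ ∀ (φ : E n → ℝ) (v : L2 Ω), ContDiff ℝ ∞ φ →
      v =ᵐ[volume.restrict Ω] φ →
      ‖v - R v‖ₑ ≤ ENNReal.ofReal ε * eLpNorm (gradient φ) 2 (volume.restrict Ω) := by
  have hm : MeasurableSet Ω := hΩ.isOpen.measurableSet
  obtain ⟨c, hc, t₀, ht₀, δ, hδ, hc1, hcone⟩ := hΩ.exists_uniform_cone
  -- `κ²` is the volume ratio of balls of radii `2t` and `c t / 2`; the squared error comes out as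
  -- `(2t)² κ²` times the squared gradient norm.
  set κ : ℝ := √((4 / c) ^ n) with hκ
  have hκ0 : 0 < κ := by positivity
  obtain ⟨t, ht, htt, htδ, htε⟩ : ∃ t > 0, t < t₀ ∧ t ≤ δ ∧ 2 * t * κ ≤ ε := by
    refine ⟨min (t₀ / 2) (min δ (ε / (2 * κ))), by positivity, ?_, ?_, ?_⟩
    · exact (min_le_left _ _).trans_lt (half_lt_self ht₀)
    · exact (min_le_right _ _).trans (min_le_left _ _)
    · have : min (t₀ / 2) (min δ (ε / (2 * κ))) ≤ ε / (2 * κ) :=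
        (min_le_right _ _).trans (min_le_right _ _)
      rw [le_div_iff₀ (by positivity)] at this
      linarith
  have hct : 0 < c * t := mul_pos hc ht
  have hctt : c * t ≤ t := mul_le_of_le_one_left ht.le hc1
  have htb : TotallyBounded Ω :=
    hΩ.isBounded.isCompact_closure.totallyBounded.subset subset_closure
  obtain ⟨T, hTΩ, hTfin, hTcov⟩ := Metric.finite_approx_of_totallyBounded htb (c * t / 4)
    (by positivity)
  let y : Fin hTfin.toFinset.card → E n := fun i => hTfin.toFinset.equivFin.symm i
  have hyT : ∀ i, y i ∈ T := fun i =>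
    hTfin.mem_toFinset.1 (hTfin.toFinset.equivFin.symm i).2
  have hyΩ : ∀ i, y i ∈ Ω := fun i => hTΩ (hyT i)
  choose e he hball using fun i => hcone (y i) (hyΩ i)
  let B : Fin hTfin.toFinset.card → Set (E n) := fun i => Metric.ball (y i + t • e i) (c * t / 2)
  let Q : Fin hTfin.toFinset.card → Set (E n) := fun i => Metric.ball (y i) (c * t / 4)
  have hQcov : Ω ⊆ ⋃ i, Q i := by
    intro x hx
    obtain ⟨p, hp, hxp⟩ := Set.mem_iUnion₂.1 (hTcov hx)
    refine Set.mem_iUnion.2 ⟨hTfin.toFinset.equivFin ⟨p, hTfin.mem_toFinset.2 hp⟩, ?_⟩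
    simpa [Q, y] using hxp
  have hPm : ∀ i, MeasurableSet (disjointed Q i) := by
    intro i
    rw [disjointed_apply, Finset.sup_set_eq_biUnion]
    exact Metric.isOpen_ball.measurableSet.diff
      (Finset.measurableSet_biUnion _ fun j _ => Metric.isOpen_ball.measurableSet)
  have hyδ : ∀ i, ∀ p ∈ Q i, p ∈ Metric.ball (y i) δ := fun i p hp =>
    Metric.ball_subset_ball (by linarith) hp
  obtain ⟨R, hRc, hR⟩ := exists_averaging hΩ.isBounded (disjointed Q) B hPm
    (fun i => Metric.isOpen_ball.measurableSet) (disjoint_disjointed Q)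
    (by rw [iUnion_disjointed]; exact hQcov)
    (fun i => (Metric.ball_subset_ball (by linarith)).trans
      (hball i (y i) (hyΩ i) (Metric.mem_ball_self hδ) t ht htt))
  refine ⟨R, hRc, fun φ v hφ hv => ?_⟩
  set b : ℝ≥0∞ := volume (Metric.ball (0 : E n) (c * t / 2)) with hb
  have hb0 : b ≠ 0 := (Metric.measure_ball_pos _ _ (by positivity)).ne'
  have hbt : b ≠ ⊤ := measure_ball_lt_top.ne
  have hBb : ∀ i, volume (B i) = b := fun i => Measure.addHaar_ball_center _ _ _
  have hpt : ∀ᵐ p ∂(volume.restrict Ω), ‖(v - R v) p‖ₑ ^ 2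
      ≤ b⁻¹ * (ENNReal.ofReal (2 * t) ^ 2 *
        ∫⁻ z in Metric.ball 0 (2 * t), ∫⁻ l in Set.Icc (0 : ℝ) 1,
          Ω.indicator (fun x => ‖gradient φ x‖ₑ ^ 2) (p + l • z)) := by
    filter_upwards [hR φ v hv, ae_restrict_mem hm] with p hp hpΩ
    obtain ⟨i, hpi, hval⟩ := hp hpΩ
    have hpQ : p ∈ Q i := disjointed_subset Q i hpi
    have hpc : ‖y i - p‖ < c * t / 4 := by
      rw [← dist_eq_norm, dist_comm]; exact hpQ
    -- The piece and the ball have radii `c t / 4` and `c t / 2`, with sum below `c t`. Hence the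
    -- averaging ball lies in the cone cross-section of every point `p` of the piece, not only of
    -- its centre.
    have hx : ∀ x ∈ B i, ‖x - (p + t • e i)‖ < c * t := by
      intro x hx
      rw [Metric.mem_ball, dist_eq_norm] at hx
      have : x - (p + t • e i) = (x - (y i + t • e i)) + (y i - p) := by abel
      rw [this]
      linarith [norm_add_le (x - (y i + t • e i)) (y i - p)]
    rw [hval, ← hBb i]
    refine sq_enorm_sub_average_le_gradient hm hφ (by positivity) ?_ ?_
    · intro x hxB
      have h1 := hx x hxB
      have h2 : ‖t • e i‖ ≤ t := by
        rw [norm_smul, Real.norm_of_nonneg ht.le]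
        exact mul_le_of_le_one_right ht.le (he i)
      have : x - p = (x - (p + t • e i)) + t • e i := by abel
      rw [this]
      linarith [norm_add_le (x - (p + t • e i)) (t • e i)]
    · intro x hxB l hl
      rcases hl.1.eq_or_lt with rfl | hl0
      · simpa using hpΩ
      -- The point at parameter `l` on the segment belongs to the cone cross-section at height `l
      -- t`.
      · refine hball i p hpΩ (hyδ i p hpQ) (l * t) (by positivity) ?_ ?_
        · exact (mul_le_of_le_one_left ht.le hl.2).trans_lt htt
        · rw [Metric.mem_ball, dist_eq_norm]
          have : p + l • (x - p) - (p + (l * t) • e i) = l • (x - (p + t • e i)) := by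
            rw [mul_smul, smul_sub, smul_sub, smul_add]; abel
          rw [this, norm_smul, Real.norm_of_nonneg hl0.le]
          calc l * ‖x - (p + t • e i)‖ < l * (c * t) := mul_lt_mul_of_pos_left (hx x hxB) hl0
            _ = c * (l * t) := by ring
  have hratio : b⁻¹ * volume (Metric.ball (0 : E n) (2 * t)) = ENNReal.ofReal ((4 / c) ^ n) := by
    have h1 : volume (Metric.ball (0 : E n) (2 * t)) = ENNReal.ofReal ((4 / c) ^ n) * b := by
      have : 2 * t = (4 / c) * (c * t / 2) := by field_simp; ring
      rw [this, Measure.addHaar_ball_mul_of_pos _ _ (by positivity), finrank_euclideanSpace_fin]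
    rw [h1, mul_comm _ b, ← mul_assoc, ENNReal.inv_mul_cancel hb0 hbt, one_mul]
  rw [Lp.enorm_def, ← ENNReal.pow_le_pow_left_iff two_ne_zero, eLpNorm_two_sq]
  calc ∫⁻ p in Ω, ‖(v - R v) p‖ₑ ^ 2
      ≤ ∫⁻ p in Ω, b⁻¹ * (ENNReal.ofReal (2 * t) ^ 2 *
        ∫⁻ z in Metric.ball 0 (2 * t), ∫⁻ l in Set.Icc (0 : ℝ) 1,
          Ω.indicator (fun x => ‖gradient φ x‖ₑ ^ 2) (p + l • z)) := lintegral_mono_ae hpt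
    _ ≤ ∫⁻ p, b⁻¹ * (ENNReal.ofReal (2 * t) ^ 2 *
        ∫⁻ z in Metric.ball 0 (2 * t), ∫⁻ l in Set.Icc (0 : ℝ) 1,
          Ω.indicator (fun x => ‖gradient φ x‖ₑ ^ 2) (p + l • z)) := setLIntegral_le_lintegral _ _
    _ = b⁻¹ * (ENNReal.ofReal (2 * t) ^ 2 * (volume (Metric.ball (0 : E n) (2 * t)) *
          eLpNorm (gradient φ) 2 (volume.restrict Ω) ^ 2)) := by
        rw [lintegral_const_mul' _ _ (ENNReal.inv_ne_top.2 hb0),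
          lintegral_const_mul' _ _ (by finiteness), lintegral_translates_le hm hφ]
    _ = (b⁻¹ * volume (Metric.ball (0 : E n) (2 * t))) * ENNReal.ofReal (2 * t) ^ 2 *
          eLpNorm (gradient φ) 2 (volume.restrict Ω) ^ 2 := by ring
    _ ≤ (ENNReal.ofReal ε * eLpNorm (gradient φ) 2 (volume.restrict Ω)) ^ 2 := by
        rw [hratio, mul_pow]
        gcongr
        rw [← ENNReal.ofReal_pow (by positivity), ← ENNReal.ofReal_mul (by positivity),
          ← ENNReal.ofReal_pow hε.le]
        refine ENNReal.ofReal_le_ofReal ?_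
        have h2 : κ ^ 2 = (4 / c) ^ n := Real.sq_sqrt (by positivity)
        rw [← h2, ← mul_pow, mul_comm κ]
        exact pow_le_pow_left₀ (by positivity) htε 2

/-- `H¹(Ω)` as a Hilbert space: a copy of `H1 Ω` whose topology is by definition that of the norm. -/
def Sobolev (Ω : Set (E n)) : Type := H1 Ω

instance : NormedAddCommGroup (Sobolev Ω) := inferInstanceAs (NormedAddCommGroup (H1 Ω))

instance : InnerProductSpace ℝ (Sobolev Ω) := inferInstanceAs (InnerProductSpace ℝ (H1 Ω))

/-- The identification of `H1 Ω` with `Sobolev Ω`. -/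
def toSobolev (Ω : Set (E n)) : H1 Ω ≃ₗ[ℝ] Sobolev Ω := LinearEquiv.refl ℝ (H1 Ω)

/-- The inner product of `H¹(Ω)`. -/
theorem inner_toSobolev (u v : H1 Ω) : inner ℝ (toSobolev Ω u) (toSobolev Ω v)
    = inner ℝ (val u) (val v) + inner ℝ (grad u) (grad v) :=
  WithLp.prod_inner_apply (u : WithLp 2 (L2 Ω × L2Vec Ω)) (v : WithLp 2 (L2 Ω × L2Vec Ω))

theorem norm_sq_toSobolev (u : H1 Ω) : ‖toSobolev Ω u‖ ^ 2 = ‖val u‖ ^ 2 + ‖grad u‖ ^ 2 :=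
  WithLp.prod_norm_sq_eq_of_L2 (u : WithLp 2 (L2 Ω × L2Vec Ω))

theorem norm_grad_le (u : H1 Ω) : ‖grad u‖ ≤ ‖toSobolev Ω u‖ := by
  refine le_of_sq_le_sq ?_ (norm_nonneg _)
  rw [norm_sq_toSobolev]
  linarith [sq_nonneg ‖val u‖]

theorem norm_val_le (u : H1 Ω) : ‖val u‖ ≤ ‖toSobolev Ω u‖ := by
  refine le_of_sq_le_sq ?_ (norm_nonneg _)
  rw [norm_sq_toSobolev]
  linarith [sq_nonneg ‖grad u‖]

/-- The embedding `H¹(Ω) → L²(Ω)`. -/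
def valL (Ω : Set (E n)) : Sobolev Ω →L[ℝ] L2 Ω :=
  LinearMap.mkContinuous
    ((WithLp.fstₗ 2 ℝ (L2 Ω) (L2Vec Ω)).comp ((H1 Ω).subtype.comp (toSobolev Ω).symm.toLinearMap)) 1
    fun u => by rw [one_mul]; exact norm_val_le ((toSobolev Ω).symm u)

@[simp] theorem valL_toSobolev (u : H1 Ω) : valL Ω (toSobolev Ω u) = val u := rfl

/-- The Rellich–Kondrachov theorem. -/
theorem IsBoundedLipschitzDomain.isCompactOperator_valL (hΩ : IsBoundedLipschitzDomain Ω) :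
    IsCompactOperator (valL Ω) := by
  have hm : MeasurableSet Ω := hΩ.isOpen.measurableSet
  -- Compact operators are closed in operator norm, so it suffices to approximate the embedding by
  -- `R.comp (valL Ω)`.
  have hmem : valL Ω ∈ closure {f : Sobolev Ω →L[ℝ] L2 Ω | IsCompactOperator f} := by
    refine Metric.mem_closure_iff.2 fun ε hε => ?_
    obtain ⟨R, hRc, hR⟩ := hΩ.exists_compact_approx (half_pos hε)
    refine ⟨R.comp (valL Ω), hRc.comp_clm _, ?_⟩
    rw [dist_eq_norm]
    refine lt_of_le_of_lt (ContinuousLinearMap.opNorm_le_bound _ (half_pos hε).le fun U => ?_)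
      (half_lt_self hε)
    obtain ⟨u, rfl⟩ := (toSobolev Ω).surjective U
    refine le_trans ?_ (mul_le_mul_of_nonneg_left (norm_grad_le u) (half_pos hε).le)
    change ‖val u - R (val u)‖ ≤ ε / 2 * ‖grad u‖
    refine le_of_forall_pos_le_add fun η hη => ?_
    -- The error bound is available for smooth functions only. Passing from `φ` to `u` costs `η / M`
    -- for `φ` itself, `ε / 2` times that for the gradient and `‖R‖` times that for `R`: in total
    -- `η`.
    set M : ℝ := 1 + ε / 2 + ‖R‖ with hM
    have hM0 : 0 < M := by positivity
    obtain ⟨φ, hφ, h1, h2⟩ := hΩ.exists_smooth_approx u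
      (ENNReal.ofReal_pos.2 (div_pos hη hM0))
    have hφL := memLp_of_continuous hΩ.isBounded hm hφ.continuous
    have hgL := memLp_of_continuous hΩ.isBounded hm (continuous_gradient hφ)
    have h1' : ‖hφL.toLp φ - val u‖ ≤ η / M := by
      have : ‖hφL.toLp φ - val u‖ₑ ≤ ENNReal.ofReal (η / M) := by
        rw [Lp.enorm_def]
        refine le_of_eq_of_le (eLpNorm_congr_ae ?_) h1
        filter_upwards [Lp.coeFn_sub (hφL.toLp φ) (val u), hφL.coeFn_toLp] with x hx hx2
        rw [hx, Pi.sub_apply, hx2]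
      rw [← ofReal_norm] at this
      exact (ENNReal.ofReal_le_ofReal_iff (by positivity)).1 this
    have h2' : ‖hgL.toLp (gradient φ) - grad u‖ ≤ η / M := by
      have : ‖hgL.toLp (gradient φ) - grad u‖ₑ ≤ ENNReal.ofReal (η / M) := by
        rw [Lp.enorm_def]
        refine le_of_eq_of_le (eLpNorm_congr_ae ?_) h2
        filter_upwards [Lp.coeFn_sub (hgL.toLp (gradient φ)) (grad u), hgL.coeFn_toLp] with x hx hx2
        rw [hx, Pi.sub_apply, hx2]
      rw [← ofReal_norm] at this
      exact (ENNReal.ofReal_le_ofReal_iff (by positivity)).1 this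
    have h3 : ‖hφL.toLp φ - R (hφL.toLp φ)‖ ≤ ε / 2 * ‖hgL.toLp (gradient φ)‖ := by
      have := hR φ (hφL.toLp φ) hφ hφL.coeFn_toLp
      rw [← eLpNorm_congr_ae hgL.coeFn_toLp, ← Lp.enorm_def, ← ofReal_norm, ← ofReal_norm,
        ← ENNReal.ofReal_mul (by positivity)] at this
      exact (ENNReal.ofReal_le_ofReal_iff (by positivity)).1 this
    have h4 : ‖R (hφL.toLp φ - val u)‖ ≤ ‖R‖ * (η / M) :=
      (R.le_opNorm _).trans (mul_le_mul_of_nonneg_left h1' (norm_nonneg _))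
    have h5 : ‖hgL.toLp (gradient φ)‖ ≤ η / M + ‖grad u‖ := by
      have := norm_add_le (hgL.toLp (gradient φ) - grad u) (grad u)
      rw [sub_add_cancel] at this
      linarith
    have h6 : val u - R (val u) = (hφL.toLp φ - R (hφL.toLp φ)) - (hφL.toLp φ - val u)
        + R (hφL.toLp φ - val u) := by
      rw [map_sub]; abel
    have h7 := norm_add_le ((hφL.toLp φ - R (hφL.toLp φ)) - (hφL.toLp φ - val u))
      (R (hφL.toLp φ - val u))
    have h8 := norm_sub_le (hφL.toLp φ - R (hφL.toLp φ)) (hφL.toLp φ - val u)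
    have h9 : ε / 2 * ‖hgL.toLp (gradient φ)‖ ≤ ε / 2 * (η / M + ‖grad u‖) :=
      mul_le_mul_of_nonneg_left h5 (half_pos hε).le
    have h10 : M * (η / M) = η := mul_div_cancel₀ _ hM0.ne'
    rw [h6]
    have h11 : (1 + ε / 2 + ‖R‖) * (η / M) = η := h10
    nlinarith
  rwa [isClosed_setOfPred_isCompactOperator.closure_eq] at hmem

end Helmholtz

/-! ### Completeness of `H¹(Ω)` and boundary charts -/

namespace Helmholtz

variable {n : ℕ} {Ω : Set (E n)}

/-- For one test function the identity says that a continuous functional of `(u, w)` vanishes; this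
makes `H1` closed as an intersection of kernels. -/
theorem isWeakGradient_iff_inner {u : L2 Ω} {w : L2Vec Ω} {φ : E n → ℝ} {e : E n}
    (h1 : MemLp (fun x => fderiv ℝ φ x e) 2 (volume.restrict Ω))
    (h2 : MemLp (fun x => φ x • e) 2 (volume.restrict Ω)) :
    ∫ x in Ω, u x * fderiv ℝ φ x e = - ∫ x in Ω, inner ℝ (w x) e * φ x ↔
      inner ℝ u (h1.toLp _) + inner ℝ w (h2.toLp _) = (0 : ℝ) := by
  have e1 : inner ℝ u (h1.toLp _) = ∫ x in Ω, u x * fderiv ℝ φ x e := by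
    rw [L2.inner_def]
    refine integral_congr_ae ?_
    filter_upwards [h1.coeFn_toLp] with x hx
    rw [hx, RCLike.inner_apply, conj_trivial, mul_comm]
  have e2 : inner ℝ w (h2.toLp _) = ∫ x in Ω, inner ℝ (w x) e * φ x := by
    rw [L2.inner_def]
    refine integral_congr_ae ?_
    filter_upwards [h2.coeFn_toLp] with x hx
    rw [hx, inner_smul_right, mul_comm]
  rw [e1, e2, eq_neg_iff_add_eq_zero]

theorem isClosed_H1 : IsClosed (H1 Ω : Set (WithLp 2 (L2 Ω × L2Vec Ω))) := by
  have h : (H1 Ω : Set (WithLp 2 (L2 Ω × L2Vec Ω))) = ⋂ (φ : E n → ℝ) (_ : ContDiff ℝ ∞ φ)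
      (_ : HasCompactSupport φ) (_ : tsupport φ ⊆ Ω) (e : E n),
      {p | ∫ x in Ω, p.fst x * fderiv ℝ φ x e = - ∫ x in Ω, inner ℝ (p.snd x) e * φ x} := by
    ext p
    simp only [Set.mem_iInter]
    rfl
  rw [h]
  refine isClosed_iInter fun φ => isClosed_iInter fun hφ => isClosed_iInter fun hc =>
    isClosed_iInter fun _ => isClosed_iInter fun e => ?_
  have h1 : MemLp (fun x => fderiv ℝ φ x e) 2 (volume.restrict Ω) :=
    ((hφ.continuous_fderiv (by simp)).clm_apply continuous_const).memLp_of_hasCompactSupport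
      (hc.fderiv_apply ℝ e)
  have h2 : MemLp (fun x => φ x • e) 2 (volume.restrict Ω) :=
    (hφ.continuous.smul continuous_const).memLp_of_hasCompactSupport hc.smul_right
  simp_rw [isWeakGradient_iff_inner h1 h2]
  have c1 : Continuous fun p : WithLp 2 (L2 Ω × L2Vec Ω) => p.fst :=
    (WithLp.fstL 2 ℝ (L2 Ω) (L2Vec Ω)).continuous
  have c2 : Continuous fun p : WithLp 2 (L2 Ω × L2Vec Ω) => p.snd :=
    (WithLp.sndL 2 ℝ (L2 Ω) (L2Vec Ω)).continuous
  exact isClosed_eq ((c1.inner continuous_const).add (c2.inner continuous_const)) continuous_const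

instance : CompleteSpace (Sobolev Ω) :=
  (isClosed_H1 (Ω := Ω)).completeSpace_coe

section Chart

theorem euclideanHausdorffMeasure_image_le {X Y : Type*} [MetricSpace X] [MetricSpace Y]
    [MeasurableSpace X] [BorelSpace X] [MeasurableSpace Y] [BorelSpace Y] {f : X → Y} {K : ℝ≥0}
    (hf : LipschitzWith K f) (d : ℕ) (s : Set X) :
    (μHE[d] : Measure Y) (f '' s) ≤ (K : ℝ≥0∞) ^ d * (μHE[d] : Measure X) s := by
  have h := hf.hausdorffMeasure_image_le (d := (d : ℝ)) (by positivity) s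
  simp only [Measure.euclideanHausdorffMeasure_def, Measure.smul_apply]
  rw [ENNReal.smul_def, ENNReal.smul_def, smul_eq_mul, smul_eq_mul, mul_left_comm]
  rw [ENNReal.rpow_natCast] at h
  gcongr

/-- The graph of `f` over the hyperplane orthogonal to `e`. -/
def graphMap (e : E n) (f : E n → ℝ) (p : (ℝ ∙ e)ᗮ) : E n := (p : E n) + f p • e

theorem lipschitzWith_graphMap {e : E n} (he : ‖e‖ = 1) {f : E n → ℝ} {K : ℝ≥0}
    (hf : LipschitzWith K f) : LipschitzWith (1 + K) (graphMap e f) := by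
  refine LipschitzWith.of_dist_le_mul fun p q => ?_
  have h : graphMap e f p - graphMap e f q = ((p : E n) - q) + (f p - f q) • e := by
    simp only [graphMap, sub_smul]; abel
  have h2 := hf.dist_le_mul (p : E n) q
  rw [Real.dist_eq, dist_eq_norm] at h2
  rw [dist_eq_norm, h, dist_eq_norm, NNReal.coe_add, NNReal.coe_one, add_mul, one_mul]
  refine (norm_add_le _ _).trans ?_
  rw [norm_smul, he, mul_one, Real.norm_eq_abs]
  exact add_le_add le_rfl h2

/-- In `U` the boundary lies in the image of a `(1 + K)`-Lipschitz map from the hyperplane, and such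
a map increases `(n-1)`-dimensional Hausdorff measure by at most `(1 + K)^(n-1)`. The upper bound is
all that the trace inequality requires. -/
theorem surfaceMeasure_restrict_le {e : E n} (he : ‖e‖ = 1) {f : E n → ℝ} {K : ℝ≥0}
    (hf : LipschitzWith K f) {U : Set (E n)} (hU : MeasurableSet U)
    (hgraph : ∀ y ∈ U, y ∈ frontier Ω → inner ℝ e y = f (y - inner ℝ e y • e)) :
    (surfaceMeasure Ω).restrict U
      ≤ (((1 + K : ℝ≥0) : ℝ≥0∞) ^ (n - 1) • (volume : Measure (ℝ ∙ e)ᗮ).map (graphMap e f)).restrict U := by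
  have hG := lipschitzWith_graphMap he hf
  have hdim : Module.finrank ℝ (ℝ ∙ e)ᗮ = n - 1 := by
    have he0 : e ≠ 0 := by rintro rfl; simp at he
    have h1 := Submodule.finrank_add_finrank_orthogonal (ℝ ∙ e)
    rw [finrank_span_singleton he0, finrank_euclideanSpace_fin] at h1
    omega
  refine Measure.le_iff.2 fun S hS => ?_
  rw [Measure.restrict_apply hS, Measure.restrict_apply hS, surfaceMeasure,
    Measure.restrict_apply (hS.inter hU), Measure.smul_apply,
    Measure.map_apply hG.continuous.measurable (hS.inter hU), smul_eq_mul,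
    ← InnerProductSpace.euclideanHausdorffMeasure_eq_volume, hdim]
  refine le_trans (measure_mono ?_) (euclideanHausdorffMeasure_image_le hG _ _)
  rintro y ⟨hy, hyf⟩
  have hp : y - inner ℝ e y • e ∈ (ℝ ∙ e)ᗮ := by
    rw [Submodule.mem_orthogonal_singleton_iff_inner_right, inner_sub_right, inner_smul_right,
      real_inner_self_eq_norm_sq, he]
    ring
  have hy' : graphMap e f ⟨_, hp⟩ = y := by
    simp only [graphMap]
    rw [← hgraph y hy.2 hyf, sub_add_cancel]
  exact ⟨⟨_, hp⟩, by rw [Set.mem_preimage, hy']; exact hy, hy'⟩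

/-- Fubini's theorem in the coordinates `(p, t) ↦ p + t e`, up to a constant. -/
theorem exists_lintegral_orthogonal_eq {e : E n} (he : ‖e‖ = 1) :
    ∃ C : ℝ≥0∞, C ≠ ⊤ ∧ ∀ g : E n → ℝ≥0∞, Measurable g →
      ∫⁻ p : (ℝ ∙ e)ᗮ, ∫⁻ t : ℝ, g (p + t • e) = C * ∫⁻ x, g x := by
  have hee : inner ℝ e e = (1 : ℝ) := by rw [real_inner_self_eq_norm_sq, he]; norm_num
  let l : ((ℝ ∙ e)ᗮ × ℝ) →ₗ[ℝ] E n :=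
    (ℝ ∙ e)ᗮ.subtype.coprod (LinearMap.toSpanSingleton ℝ (E n) e)
  have hl : ∀ p, l p = (p.1 : E n) + p.2 • e := fun p => by
    simp [l, LinearMap.coprod_apply]
  have hbij : Function.Bijective l := by
    constructor
    · refine (injective_iff_map_eq_zero l).2 fun p hp => ?_
      rw [hl] at hp
      have h1 : inner ℝ e ((p.1 : E n) + p.2 • e) = (0 : ℝ) := by rw [hp, inner_zero_right]
      rw [inner_add_right, inner_smul_right, hee, mul_one,
        (Submodule.mem_orthogonal_singleton_iff_inner_right).1 p.1.2, zero_add] at h1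
      rw [h1, zero_smul, add_zero] at hp
      exact Prod.ext (Subtype.ext hp) h1
    · intro x
      have hp : x - inner ℝ e x • e ∈ (ℝ ∙ e)ᗮ := by
        rw [Submodule.mem_orthogonal_singleton_iff_inner_right, inner_sub_right, inner_smul_right,
          hee]
        ring
      exact ⟨(⟨_, hp⟩, inner ℝ e x), by rw [hl]; simp⟩
  let L : ((ℝ ∙ e)ᗮ × ℝ) ≃L[ℝ] E n := (LinearEquiv.ofBijective l hbij).toContinuousLinearEquiv
  have hL : ∀ p, L p = (p.1 : E n) + p.2 • e := hl
  let ν : Measure (E n) := ((volume : Measure (ℝ ∙ e)ᗮ).prod (volume : Measure ℝ)).map L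
  have : ν.IsAddHaarMeasure := L.isAddHaarMeasure_map _
  refine ⟨Measure.addHaarScalarFactor ν volume, ENNReal.coe_ne_top, fun g hg => ?_⟩
  -- The pushed-forward product measure is a Haar measure, so uniqueness gives the constant; its
  -- value is irrelevant.
  have hν : ν = Measure.addHaarScalarFactor ν volume • (volume : Measure (E n)) :=
    Measure.isAddLeftInvariant_eq_smul ν volume
  have h1 : ∫⁻ x, g x ∂ν = Measure.addHaarScalarFactor ν volume * ∫⁻ x, g x := by
    conv_lhs => rw [hν]
    rw [lintegral_smul_measure, ENNReal.smul_def, smul_eq_mul]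
  rw [← h1, lintegral_map hg L.continuous.measurable, lintegral_prod]
  · simp_rw [hL]
  · exact (hg.comp L.continuous.measurable).aemeasurable

end Chart

end Helmholtz

namespace Helmholtz

variable {n : ℕ} {Ω : Set (E n)}

/-! ### The trace inequality for smooth functions -/

section TraceInequality

/-- One-dimensional trace inequality along the segment from `y` to `y + s e`. -/
theorem sq_enorm_le_lintegral_segment {φ : E n → ℝ} (hφ : ContDiff ℝ ∞ φ) {e : E n} (he : ‖e‖ = 1)
    (y : E n) (s : ℝ) :
    ENNReal.ofReal s * ‖φ y‖ₑ ^ 2 ≤ ∫⁻ t in Set.Ioc 0 s,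
      (2 * ‖φ (y + t • e)‖ₑ ^ 2 + 2 * ENNReal.ofReal s ^ 2 * ‖gradient φ (y + t • e)‖ₑ ^ 2) := by
  have hline : Continuous fun t : ℝ => y + t • e := by fun_prop
  have hm1 : Measurable fun t : ℝ => ‖φ (y + t • e)‖ₑ ^ 2 :=
    (hφ.continuous.comp hline).measurable.enorm.pow_const 2
  have hm2 : Measurable fun t : ℝ => ‖gradient φ (y + t • e)‖ₑ ^ 2 :=
    ((continuous_gradient hφ).comp hline).measurable.enorm.pow_const 2
  set I : ℝ≥0∞ := ∫⁻ t in Set.Ioc 0 s, ‖gradient φ (y + t • e)‖ₑ ^ 2 with hI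
  -- The value at `y` is bounded through the value at `y + t e` and the gradient between them;
  -- integration over `t` then yields the claim.
  have hpt : ∀ t ∈ Set.Ioc 0 s,
      ‖φ y‖ₑ ^ 2 ≤ 2 * ‖φ (y + t • e)‖ₑ ^ 2 + 2 * (ENNReal.ofReal s * I) := by
    intro t ht
    have h1 : ‖φ y‖ₑ ≤ ‖φ (y + t • e)‖ₑ + ‖φ (y + t • e) - φ y‖ₑ := by
      have h := enorm_sub_le (E := ℝ) (a := φ (y + t • e)) (b := φ (y + t • e) - φ y)
      rwa [sub_sub_cancel] at h
    have h2 := enorm_sub_sq_le_lintegral_gradient hφ y e ht.1.le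
    have he' : ‖e‖ₑ = 1 := by rw [← ofReal_norm, he, ENNReal.ofReal_one]
    rw [he', one_pow, one_mul, ← restrict_Ioc_eq_restrict_Icc] at h2
    have h3 : ENNReal.ofReal t * ∫⁻ l in Set.Ioc 0 t, ‖gradient φ (y + l • e)‖ₑ ^ 2
        ≤ ENNReal.ofReal s * I := by
      refine mul_le_mul' (ENNReal.ofReal_le_ofReal ht.2) ?_
      exact lintegral_mono_set (Set.Ioc_subset_Ioc_right ht.2)
    refine (pow_le_pow_left' h1 2).trans ((add_sq_le _ _).trans ?_)
    gcongr
    exact h2.trans h3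
  calc ENNReal.ofReal s * ‖φ y‖ₑ ^ 2 = ∫⁻ _t in Set.Ioc 0 s, ‖φ y‖ₑ ^ 2 := by
        rw [setLIntegral_const, Real.volume_Ioc, sub_zero, mul_comm]
    _ ≤ ∫⁻ t in Set.Ioc 0 s, (2 * ‖φ (y + t • e)‖ₑ ^ 2 + 2 * (ENNReal.ofReal s * I)) :=
        setLIntegral_mono' measurableSet_Ioc hpt
    _ = _ := by
        rw [lintegral_add_left (hm1.const_mul 2), lintegral_add_left (hm1.const_mul 2),
          setLIntegral_const, Real.volume_Ioc, sub_zero, lintegral_const_mul _ hm2]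
        ring

/-- The segments from graph points in direction `e` run into `Ω`. The one-dimensional inequality on
them, integrated over the hyperplane, becomes a volume integral by Fubini. -/
theorem IsBoundedLipschitzDomain.exists_local_trace_inequality (hΩ : IsBoundedLipschitzDomain Ω)
    {x : E n} (hx : x ∈ frontier Ω) :
    ∃ U ∈ 𝓝 x, ∃ C : ℝ≥0∞, C ≠ ⊤ ∧ ∀ φ : E n → ℝ, ContDiff ℝ ∞ φ →
      ∫⁻ y in U, ‖φ y‖ₑ ^ 2 ∂(surfaceMeasure Ω)
        ≤ C * (eLpNorm φ 2 (volume.restrict Ω) ^ 2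
          + eLpNorm (gradient φ) 2 (volume.restrict Ω) ^ 2) := by
  obtain ⟨e, f, K, r, he, hf, hr, hch⟩ := hΩ.lipschitz_boundary x hx
  have hm : MeasurableSet Ω := hΩ.isOpen.measurableSet
  have hee : inner ℝ e e = (1 : ℝ) := by rw [real_inner_self_eq_norm_sq, he]; norm_num
  set U := Metric.ball x (r / 2) with hU
  have hG := lipschitzWith_graphMap he hf
  have hshift : ∀ (y : E n) (t : ℝ), inner ℝ e (y + t • e) = inner ℝ e y + t ∧
      (y + t • e) - inner ℝ e (y + t • e) • e = y - inner ℝ e y • e := by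
    intro y t
    have h1 : inner ℝ e (y + t • e) = inner ℝ e y + t := by
      rw [inner_add_right, inner_smul_right, hee, mul_one]
    exact ⟨h1, by rw [h1, add_smul]; abel⟩
  -- A frontier point is not above the graph, since it is not in the open set `Ω`, and not below it,
  -- since then a whole neighbourhood would miss `Ω`.
  have hgraph : ∀ y ∈ U, y ∈ frontier Ω → inner ℝ e y = f (y - inner ℝ e y • e) := by
    intro y hyU hyf
    have hyr : y ∈ Metric.ball x r := Metric.ball_subset_ball (by linarith) hyU
    have hcont : Continuous fun z : E n => f (z - inner ℝ e z • e) :=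
      hf.continuous.comp (by fun_prop)
    have hcont2 : Continuous fun z : E n => (inner ℝ e z : ℝ) := by fun_prop
    rw [hΩ.isOpen.frontier_eq] at hyf
    refine le_antisymm ?_ ?_
    · have := fun h => hyf.2 ((hch y hyr).2 h)
      exact not_lt.1 this
    · by_contra! hlt
      have hev : ∀ᶠ z in 𝓝 y, z ∉ Ω := by
        filter_upwards [hcont2.continuousAt.eventually_lt hcont.continuousAt hlt,
          Metric.isOpen_ball.mem_nhds hyr] with z hz hzr hzΩ
        exact lt_asymm hz ((hch z hzr).1 hzΩ)
      exact (mem_closure_iff_frequently.1 hyf.1) hev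
  obtain ⟨C', hC', hfub⟩ := exists_lintegral_orthogonal_eq he
  set s : ℝ := r / 2 with hs
  have hs0 : 0 < s := by positivity
  have hos : ENNReal.ofReal s ≠ 0 := (ENNReal.ofReal_pos.2 hs0).ne'
  set D : ℝ≥0∞ := ((1 + K : ℝ≥0) : ℝ≥0∞) ^ (n - 1) with hD
  have hDt : D ≠ ⊤ := ENNReal.pow_ne_top ENNReal.coe_ne_top
  refine ⟨U, Metric.ball_mem_nhds x hs0,
    D * ((ENNReal.ofReal s)⁻¹ * C') * (2 + 2 * ENNReal.ofReal s ^ 2), by finiteness,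
    fun φ hφ => ?_⟩
  have hm1 : Measurable fun y => ‖φ y‖ₑ ^ 2 := hφ.continuous.measurable.enorm.pow_const 2
  have hm2 : Measurable fun y => ‖gradient φ y‖ₑ ^ 2 :=
    (continuous_gradient hφ).measurable.enorm.pow_const 2
  set g : E n → ℝ≥0∞ := Ω.indicator fun y =>
    2 * ‖φ y‖ₑ ^ 2 + 2 * ENNReal.ofReal s ^ 2 * ‖gradient φ y‖ₑ ^ 2 with hg
  have hgm : Measurable g := ((hm1.const_mul _).add (hm2.const_mul _)).indicator hm
  have hgint : ∫⁻ y, g y ≤ (2 + 2 * ENNReal.ofReal s ^ 2) *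
      (eLpNorm φ 2 (volume.restrict Ω) ^ 2 + eLpNorm (gradient φ) 2 (volume.restrict Ω) ^ 2) := by
    rw [hg, lintegral_indicator hm, lintegral_add_left (hm1.const_mul _),
      lintegral_const_mul _ hm1, lintegral_const_mul _ hm2, eLpNorm_two_sq, eLpNorm_two_sq, mul_add]
    gcongr
    · exact le_self_add
    · exact le_add_self
  have hpt : ∀ p : (ℝ ∙ e)ᗮ, U.indicator (fun y => ‖φ y‖ₑ ^ 2) (graphMap e f p)
      ≤ (ENNReal.ofReal s)⁻¹ * ∫⁻ t : ℝ, g (p + t • e) := by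
    intro p
    by_cases hp : graphMap e f p ∈ U
    swap
    · rw [Set.indicator_of_notMem hp]; exact zero_le
    rw [Set.indicator_of_mem hp, ← ENNReal.div_eq_inv_mul, ENNReal.le_div_iff_mul_le (.inl hos)
      (.inl ENNReal.ofReal_ne_top), mul_comm]
    refine (sq_enorm_le_lintegral_segment hφ he _ s).trans ?_
    have hΓ : ∀ t ∈ Set.Ioo 0 s, graphMap e f p + t • e ∈ Ω := by
      intro t ht
      have hep : inner ℝ e (p : E n) = (0 : ℝ) :=
        (Submodule.mem_orthogonal_singleton_iff_inner_right).1 p.2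
      have h1 : inner ℝ e (graphMap e f p) = f p := by
        rw [graphMap, inner_add_right, inner_smul_right, hee, hep, zero_add, mul_one]
      have h2 : graphMap e f p - inner ℝ e (graphMap e f p) • e = p := by
        rw [h1, graphMap, add_sub_cancel_right]
      refine (hch _ ?_).2 ?_
      · rw [hU, Metric.mem_ball, dist_eq_norm] at hp
        rw [Metric.mem_ball, dist_eq_norm, add_sub_right_comm]
        refine (norm_add_le _ _).trans_lt ?_
        rw [norm_smul, he, mul_one, Real.norm_of_nonneg ht.1.le]
        linarith [ht.2]
      · rw [(hshift _ t).2, (hshift _ t).1, h2, h1]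
        linarith [ht.1]
    -- Shifting `t` by `f p` trades the base point on the graph for its projection to the
    -- hyperplane, without changing the integral over the line.
    have hg1 : ∀ t : ℝ, g (graphMap e f p + t • e) = g (p + (t + f p) • e) := by
      intro t
      rw [graphMap, add_smul]
      congr 1
      abel
    calc ∫⁻ t in Set.Ioc 0 s, (2 * ‖φ (graphMap e f p + t • e)‖ₑ ^ 2
            + 2 * ENNReal.ofReal s ^ 2 * ‖gradient φ (graphMap e f p + t • e)‖ₑ ^ 2)
        = ∫⁻ t in Set.Ioo 0 s, (2 * ‖φ (graphMap e f p + t • e)‖ₑ ^ 2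
            + 2 * ENNReal.ofReal s ^ 2 * ‖gradient φ (graphMap e f p + t • e)‖ₑ ^ 2) := by
          rw [restrict_Ioo_eq_restrict_Ioc]
      _ ≤ ∫⁻ t in Set.Ioo 0 s, g (graphMap e f p + t • e) := by
          refine setLIntegral_mono' measurableSet_Ioo fun t ht => ?_
          rw [hg, Set.indicator_of_mem (hΓ t ht)]
      _ ≤ ∫⁻ t, g (graphMap e f p + t • e) := setLIntegral_le_lintegral _ _
      _ = ∫⁻ t : ℝ, g (p + t • e) := by
          simp_rw [hg1]
          exact lintegral_add_right_eq_self (fun t : ℝ => g (p + t • e)) (f p)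
  have hind : Measurable (U.indicator fun y => ‖φ y‖ₑ ^ 2) :=
    hm1.indicator Metric.isOpen_ball.measurableSet
  calc ∫⁻ y in U, ‖φ y‖ₑ ^ 2 ∂(surfaceMeasure Ω)
      ≤ ∫⁻ y in U, ‖φ y‖ₑ ^ 2 ∂(D • (volume : Measure (ℝ ∙ e)ᗮ).map (graphMap e f)) :=
        lintegral_mono' (surfaceMeasure_restrict_le he hf Metric.isOpen_ball.measurableSet hgraph)
          le_rfl
    _ = D * ∫⁻ p : (ℝ ∙ e)ᗮ, U.indicator (fun y => ‖φ y‖ₑ ^ 2) (graphMap e f p) := by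
        rw [← lintegral_indicator Metric.isOpen_ball.measurableSet, lintegral_smul_measure,
          lintegral_map hind hG.continuous.measurable, smul_eq_mul]
    _ ≤ D * ∫⁻ p : (ℝ ∙ e)ᗮ, (ENNReal.ofReal s)⁻¹ * ∫⁻ t : ℝ, g (p + t • e) := by
        gcongr with p
        exact hpt p
    _ = D * ((ENNReal.ofReal s)⁻¹ * (C' * ∫⁻ y, g y)) := by
        rw [lintegral_const_mul' _ _ (ENNReal.inv_ne_top.2 hos), hfub g hgm]
    _ ≤ D * ((ENNReal.ofReal s)⁻¹ * (C' * ((2 + 2 * ENNReal.ofReal s ^ 2) *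
      (eLpNorm φ 2 (volume.restrict Ω) ^ 2
        + eLpNorm (gradient φ) 2 (volume.restrict Ω) ^ 2)))) := by gcongr
    _ = _ := by ring

theorem IsBoundedLipschitzDomain.exists_trace_inequality (hΩ : IsBoundedLipschitzDomain Ω) :
    ∃ C : ℝ≥0∞, C ≠ ⊤ ∧ ∀ φ : E n → ℝ, ContDiff ℝ ∞ φ →
      eLpNorm φ 2 (surfaceMeasure Ω) ≤ C * (eLpNorm φ 2 (volume.restrict Ω)
          + eLpNorm (gradient φ) 2 (volume.restrict Ω)) := by
  have hloc := fun x (hx : x ∈ frontier Ω) => hΩ.exists_local_trace_inequality hx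
  choose! U hU C hC hle using hloc
  have hK : IsCompact (frontier Ω) :=
    hΩ.isBounded.isCompact_closure.of_isClosed_subset isClosed_frontier frontier_subset_closure
  obtain ⟨S, hS, hcov⟩ := hK.elim_nhds_subcover U hU
  set A : ℝ≥0∞ := ∑ x ∈ S, C x with hA
  have hAt : A ≠ ⊤ := ENNReal.sum_ne_top.2 fun x hx => hC x (hS x hx)
  -- The local estimates bound the square of the norm by a multiple `A`, and `A ≤ (A + 1)²` avoids a
  -- square root.
  refine ⟨A + 1, by finiteness, fun φ hφ => ?_⟩
  set a := eLpNorm φ 2 (volume.restrict Ω)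
  set b := eLpNorm (gradient φ) 2 (volume.restrict Ω)
  rw [← ENNReal.pow_le_pow_left_iff two_ne_zero, eLpNorm_two_sq]
  calc ∫⁻ y, ‖φ y‖ₑ ^ 2 ∂(surfaceMeasure Ω)
      = ∫⁻ y in frontier Ω, ‖φ y‖ₑ ^ 2 ∂(surfaceMeasure Ω) := by
        rw [surfaceMeasure, Measure.restrict_restrict isClosed_frontier.measurableSet,
          Set.inter_self]
    _ ≤ ∫⁻ y in ⋃ x ∈ S, U x, ‖φ y‖ₑ ^ 2 ∂(surfaceMeasure Ω) := lintegral_mono_set hcov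
    _ ≤ ∑ x ∈ S, ∫⁻ y in U x, ‖φ y‖ₑ ^ 2 ∂(surfaceMeasure Ω) := by
        have hun : ⋃ x ∈ S, U x = ⋃ x : S, U x := by ext y; simp
        rw [← S.tsum_subtype fun x => ∫⁻ y in U x, ‖φ y‖ₑ ^ 2 ∂(surfaceMeasure Ω), hun]
        exact lintegral_iUnion_le _ _
    _ ≤ ∑ x ∈ S, C x * (a ^ 2 + b ^ 2) :=
        Finset.sum_le_sum fun x hx => hle x (hS x hx) φ hφ
    _ = A * (a ^ 2 + b ^ 2) := by rw [← Finset.sum_mul]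
    _ ≤ (A + 1) ^ 2 * (a + b) ^ 2 := by
        refine mul_le_mul' ?_ ?_
        · calc A ≤ A ^ 2 + 2 * A + 1 := by
                refine le_trans ?_ le_self_add
                refine le_trans ?_ le_add_self
                rw [two_mul]; exact le_self_add
            _ = _ := by ring
        · calc a ^ 2 + b ^ 2 ≤ a ^ 2 + b ^ 2 + 2 * a * b := le_self_add
            _ = _ := by ring
    _ = _ := by ring

end TraceInequality

end Helmholtz

namespace Helmholtz

variable {n : ℕ} {Ω : Set (E n)}

/-! ### The trace operator on `H¹(Ω)` -/

section Trace

theorem gradient_add_apply {φ ψ : E n → ℝ} (hφ : ContDiff ℝ ∞ φ) (hψ : ContDiff ℝ ∞ ψ) (x : E n) :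
    gradient (fun x => φ x + ψ x) x = gradient φ x + gradient ψ x := by
  simp only [gradient]
  rw [fderiv_fun_add (hφ.differentiable (by simp) x) (hψ.differentiable (by simp) x), map_add]

theorem gradient_const_mul_apply {φ : E n → ℝ} (hφ : ContDiff ℝ ∞ φ) (c : ℝ) (x : E n) :
    gradient (fun x => c * φ x) x = c • gradient φ x := by
  simp only [gradient]
  rw [fderiv_const_mul (hφ.differentiable (by simp) x), map_smul]

theorem gradient_sub_apply {φ ψ : E n → ℝ} (hφ : ContDiff ℝ ∞ φ) (hψ : ContDiff ℝ ∞ ψ) (x : E n) :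
    gradient (fun x => φ x - ψ x) x = gradient φ x - gradient ψ x := by
  simp only [gradient]
  rw [fderiv_fun_sub (hφ.differentiable (by simp) x) (hψ.differentiable (by simp) x), map_sub]

theorem tendsto_eLpNorm_add {α F : Type*} [MeasurableSpace α] {μ : Measure α}
    [NormedAddCommGroup F] {f g : ℕ → α → F} {h : ℕ → α → F}
    (hfm : ∀ j, AEStronglyMeasurable (f j) μ) (hgm : ∀ j, AEStronglyMeasurable (g j) μ)
    (hf : Tendsto (fun j => eLpNorm (f j) 2 μ) atTop (𝓝 0))
    (hg : Tendsto (fun j => eLpNorm (g j) 2 μ) atTop (𝓝 0))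
    (hh : ∀ j, h j =ᵐ[μ] f j + g j) :
    Tendsto (fun j => eLpNorm (h j) 2 μ) atTop (𝓝 0) := by
  have h0 := hf.add hg
  rw [add_zero] at h0
  refine tendsto_of_tendsto_of_tendsto_of_le_of_le tendsto_const_nhds h0 (fun j => zero_le)
    fun j => ?_
  change eLpNorm (h j) 2 μ ≤ _
  rw [eLpNorm_congr_ae (hh j)]
  exact eLpNorm_add_le (hfm j) (hgm j) (by norm_num)

theorem tendsto_eLpNorm_smul {α F : Type*} [MeasurableSpace α] {μ : Measure α}
    [NormedAddCommGroup F] [NormedSpace ℝ F] {f : ℕ → α → F} {h : ℕ → α → F} (c : ℝ)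
    (hf : Tendsto (fun j => eLpNorm (f j) 2 μ) atTop (𝓝 0))
    (hh : ∀ j, h j =ᵐ[μ] c • f j) :
    Tendsto (fun j => eLpNorm (h j) 2 μ) atTop (𝓝 0) := by
  have h0 := ENNReal.Tendsto.const_mul (a := ‖c‖ₑ) hf (.inr enorm_ne_top)
  rw [mul_zero] at h0
  refine h0.congr fun j => ?_
  rw [eLpNorm_congr_ae (hh j), eLpNorm_const_smul]

theorem IsTrace.add {u v : H1 Ω} {σ τ : L2Bdry Ω} (hu : IsTrace u σ) (hv : IsTrace v τ) :
    IsTrace (u + v) (σ + τ) := by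
  obtain ⟨φ, hφ, a1, a2, a3⟩ := hu
  obtain ⟨ψ, hψ, b1, b2, b3⟩ := hv
  refine ⟨fun j x => φ j x + ψ j x, fun j => (hφ j).add (hψ j), ?_, ?_, ?_⟩
  · refine tendsto_eLpNorm_add (fun j => ?_) (fun j => ?_) a1 b1 fun j => ?_
    · exact (hφ j).continuous.aestronglyMeasurable.sub (Lp.aestronglyMeasurable _)
    · exact (hψ j).continuous.aestronglyMeasurable.sub (Lp.aestronglyMeasurable _)
    · filter_upwards [Lp.coeFn_add (val u) (val v)] with x hx
      change φ j x + ψ j x - (val u + val v) x = _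
      rw [hx]
      simp only [Pi.add_apply]
      ring
  · refine tendsto_eLpNorm_add (fun j => ?_) (fun j => ?_) a2 b2 fun j => ?_
    · exact (continuous_gradient (hφ j)).aestronglyMeasurable.sub (Lp.aestronglyMeasurable _)
    · exact (continuous_gradient (hψ j)).aestronglyMeasurable.sub (Lp.aestronglyMeasurable _)
    · filter_upwards [Lp.coeFn_add (grad u) (grad v)] with x hx
      change gradient (fun x => φ j x + ψ j x) x - (grad u + grad v) x = _
      rw [hx, gradient_add_apply (hφ j) (hψ j)]
      simp only [Pi.add_apply]
      abel
  · refine tendsto_eLpNorm_add (fun j => ?_) (fun j => ?_) a3 b3 fun j => ?_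
    · exact (hφ j).continuous.aestronglyMeasurable.sub (Lp.aestronglyMeasurable _)
    · exact (hψ j).continuous.aestronglyMeasurable.sub (Lp.aestronglyMeasurable _)
    · filter_upwards [Lp.coeFn_add σ τ] with x hx
      rw [hx]
      simp only [Pi.add_apply]
      ring

theorem IsTrace.smul {u : H1 Ω} {σ : L2Bdry Ω} (hu : IsTrace u σ) (c : ℝ) :
    IsTrace (c • u) (c • σ) := by
  obtain ⟨φ, hφ, a1, a2, a3⟩ := hu
  refine ⟨fun j x => c * φ j x, fun j => contDiff_const.mul (hφ j), ?_, ?_, ?_⟩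
  · refine tendsto_eLpNorm_smul c a1 fun j => ?_
    filter_upwards [Lp.coeFn_smul c (val u)] with x hx
    change c * φ j x - (c • val u) x = _
    rw [hx]
    simp only [Pi.smul_apply, smul_eq_mul]
    ring
  · refine tendsto_eLpNorm_smul c a2 fun j => ?_
    filter_upwards [Lp.coeFn_smul c (grad u)] with x hx
    change gradient (fun x => c * φ j x) x - (c • grad u) x = _
    rw [hx, gradient_const_mul_apply (hφ j)]
    simp only [Pi.smul_apply, smul_sub]
  · refine tendsto_eLpNorm_smul c a3 fun j => ?_
    filter_upwards [Lp.coeFn_smul c σ] with x hx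
    rw [hx]
    simp only [Pi.smul_apply, smul_eq_mul]
    ring

/-- The trace inequality survives the limit along the approximating sequence. It gives both
uniqueness and boundedness of the trace. -/
theorem IsTrace.enorm_le {C : ℝ≥0∞} (hCt : C ≠ ⊤) (hC : ∀ φ : E n → ℝ, ContDiff ℝ ∞ φ →
      eLpNorm φ 2 (surfaceMeasure Ω) ≤ C * (eLpNorm φ 2 (volume.restrict Ω)
          + eLpNorm (gradient φ) 2 (volume.restrict Ω)))
    {u : H1 Ω} {τ : L2Bdry Ω} (hu : IsTrace u τ) :
    ‖τ‖ₑ ≤ C * (‖val u‖ₑ + ‖grad u‖ₑ) := by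
  obtain ⟨φ, hφ, h1, h2, h3⟩ := hu
  have hbound : ∀ j, ‖τ‖ₑ ≤ eLpNorm (fun x => φ j x - τ x) 2 (surfaceMeasure Ω)
      + C * ((eLpNorm (fun x => φ j x - val u x) 2 (volume.restrict Ω) + ‖val u‖ₑ)
        + (eLpNorm (fun x => gradient (φ j) x - grad u x) 2 (volume.restrict Ω) + ‖grad u‖ₑ)) := by
    intro j
    have e1 : ‖τ‖ₑ ≤ eLpNorm (fun x => φ j x - τ x) 2 (surfaceMeasure Ω)
        + eLpNorm (φ j) 2 (surfaceMeasure Ω) := by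
      have h := eLpNorm_sub_le (p := 2) (μ := surfaceMeasure Ω)
        (hφ j).continuous.aestronglyMeasurable
        ((hφ j).continuous.aestronglyMeasurable.sub (Lp.aestronglyMeasurable τ)) (by norm_num)
      rw [sub_sub_cancel, ← Lp.enorm_def, add_comm] at h
      exact h
    have e2 : eLpNorm (φ j) 2 (volume.restrict Ω)
        ≤ eLpNorm (fun x => φ j x - val u x) 2 (volume.restrict Ω) + ‖val u‖ₑ := by
      have h := eLpNorm_add_le (p := 2) (μ := volume.restrict Ω)
        ((hφ j).continuous.aestronglyMeasurable.sub (Lp.aestronglyMeasurable (val u)))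
        (Lp.aestronglyMeasurable (val u)) (by norm_num)
      rw [sub_add_cancel, ← Lp.enorm_def] at h
      exact h
    have e3 : eLpNorm (gradient (φ j)) 2 (volume.restrict Ω)
        ≤ eLpNorm (fun x => gradient (φ j) x - grad u x) 2 (volume.restrict Ω) + ‖grad u‖ₑ := by
      have h := eLpNorm_add_le (p := 2) (μ := volume.restrict Ω)
        ((continuous_gradient (hφ j)).aestronglyMeasurable.sub (Lp.aestronglyMeasurable (grad u)))
        (Lp.aestronglyMeasurable (grad u)) (by norm_num)
      rw [sub_add_cancel, ← Lp.enorm_def] at h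
      exact h
    refine e1.trans (add_le_add le_rfl ((hC _ (hφ j)).trans ?_))
    gcongr
  have hlim := h3.add (ENNReal.Tendsto.const_mul (a := C)
    ((h1.add_const ‖val u‖ₑ).add (h2.add_const ‖grad u‖ₑ)) (.inr hCt))
  simp only [zero_add] at hlim
  exact ge_of_tendsto' hlim hbound

/-- By the trace inequality, the boundary values of smooth functions converging in `H¹(Ω)` form a
Cauchy sequence in `L²(∂Ω)`. -/
theorem IsBoundedLipschitzDomain.exists_isTrace (hΩ : IsBoundedLipschitzDomain Ω) (u : H1 Ω) :
    ∃ τ : L2Bdry Ω, IsTrace u τ := by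
  obtain ⟨C, hCt, hC⟩ := hΩ.exists_trace_inequality
  have hm : MeasurableSet Ω := hΩ.isOpen.measurableSet
  let ε : ℕ → ℝ≥0∞ := fun j => ((j : ℝ≥0∞) + 1)⁻¹
  have hε : ∀ j, 0 < ε j := fun j => ENNReal.inv_pos.2 (by finiteness)
  have hεlim : Tendsto ε atTop (𝓝 0) := by
    have h := (tendsto_add_atTop_iff_nat 1).2 ENNReal.tendsto_inv_nat_nhds_zero
    refine h.congr fun j => ?_
    simp [ε]
  have hεanti : Antitone ε := fun i j hij => by
    refine ENNReal.inv_le_inv.2 ?_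
    gcongr
  choose φ hφ h1 h2 using fun j => hΩ.exists_smooth_approx u (hε j)
  have hφL : ∀ j, MemLp (φ j) 2 (surfaceMeasure Ω) := fun j =>
    ⟨(hφ j).continuous.aestronglyMeasurable, (hC _ (hφ j)).trans_lt (by
      have a1 := (memLp_of_continuous hΩ.isBounded hm (hφ j).continuous).eLpNorm_ne_top
      have a2 := (memLp_of_continuous hΩ.isBounded hm (continuous_gradient (hφ j))).eLpNorm_ne_top
      finiteness)⟩
  let T : ℕ → L2Bdry Ω := fun j => (hφL j).toLp (φ j)
  have hdist : ∀ i j, edist (T i) (T j) ≤ C * ((ε i + ε j) + (ε i + ε j)) := by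
    intro i j
    have e0 : edist (T i) (T j) = eLpNorm (fun x => φ i x - φ j x) 2 (surfaceMeasure Ω) := by
      rw [Lp.edist_toLp_toLp]; rfl
    rw [e0]
    refine (hC _ ((hφ i).sub (hφ j))).trans ?_
    have e1 : eLpNorm (fun x => φ i x - φ j x) 2 (volume.restrict Ω) ≤ ε i + ε j := by
      have h := eLpNorm_sub_le (p := 2) (μ := volume.restrict Ω)
        ((hφ i).continuous.aestronglyMeasurable.sub (Lp.aestronglyMeasurable (val u)))
        ((hφ j).continuous.aestronglyMeasurable.sub (Lp.aestronglyMeasurable (val u)))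
        (by norm_num)
      rw [sub_sub_sub_cancel_right] at h
      exact h.trans (add_le_add (h1 i) (h1 j))
    have e2 : eLpNorm (gradient fun x => φ i x - φ j x) 2 (volume.restrict Ω) ≤ ε i + ε j := by
      have h := eLpNorm_sub_le (p := 2) (μ := volume.restrict Ω)
        ((continuous_gradient (hφ i)).aestronglyMeasurable.sub (Lp.aestronglyMeasurable (grad u)))
        ((continuous_gradient (hφ j)).aestronglyMeasurable.sub (Lp.aestronglyMeasurable (grad u)))
        (by norm_num)
      rw [sub_sub_sub_cancel_right] at h
      have hg : (gradient fun x => φ i x - φ j x) = gradient (φ i) - gradient (φ j) :=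
        funext fun x => gradient_sub_apply (hφ i) (hφ j) x
      rw [hg]
      exact h.trans (add_le_add (h2 i) (h2 j))
    gcongr
  have hcauchy : CauchySeq T := by
    refine EMetric.cauchySeq_iff_le_tendsto_0.2
      ⟨fun N => C * ((ε N + ε N) + (ε N + ε N)), fun i j N hi hj => (hdist i j).trans ?_, ?_⟩
    · have a1 := hεanti hi
      have a2 := hεanti hj
      exact mul_le_mul' le_rfl (add_le_add (add_le_add a1 a2) (add_le_add a1 a2))
    · have h := ENNReal.Tendsto.const_mul (a := C)
        ((hεlim.add hεlim).add (hεlim.add hεlim)) (.inr hCt)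
      simpa using h
  obtain ⟨τ, hτ⟩ := cauchySeq_tendsto_of_complete hcauchy
  refine ⟨τ, φ, hφ, ?_, ?_, ?_⟩
  · exact tendsto_of_tendsto_of_tendsto_of_le_of_le tendsto_const_nhds hεlim (fun j => zero_le) h1
  · exact tendsto_of_tendsto_of_tendsto_of_le_of_le tendsto_const_nhds hεlim (fun j => zero_le) h2
  · have h := (tendsto_iff_edist_tendsto_0).1 hτ
    refine h.congr fun j => ?_
    rw [Lp.edist_def]
    refine eLpNorm_congr_ae ?_
    filter_upwards [(hφL j).coeFn_toLp] with x hx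
    rw [Pi.sub_apply, hx]

/-- The trace operator `H¹(Ω) → L²(∂Ω)`. -/
theorem IsBoundedLipschitzDomain.exists_trace (hΩ : IsBoundedLipschitzDomain Ω) :
    ∃ γ : Sobolev Ω →L[ℝ] L2Bdry Ω, ∀ (u : H1 Ω) (τ : L2Bdry Ω),
      IsTrace u τ ↔ γ (toSobolev Ω u) = τ := by
  obtain ⟨C, hCt, hC⟩ := hΩ.exists_trace_inequality
  -- The difference of two traces of `u` is a trace of `0`, hence zero by the estimate.
  have huniq : ∀ {u : H1 Ω} {σ τ : L2Bdry Ω}, IsTrace u σ → IsTrace u τ → σ = τ := by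
    intro u σ τ hσ hτ
    have h := (hσ.add (hτ.smul (-1))).enorm_le hCt hC
    have h0 : u + (-1 : ℝ) • u = 0 := by rw [neg_one_smul, add_neg_cancel]
    have h0' : σ + (-1 : ℝ) • τ = σ - τ := by rw [neg_one_smul, sub_eq_add_neg]
    rw [h0, h0'] at h
    have hv : ‖val (0 : H1 Ω)‖ₑ = 0 := by
      rw [enorm_eq_zero]; rfl
    have hg : ‖grad (0 : H1 Ω)‖ₑ = 0 := by
      rw [enorm_eq_zero]; rfl
    rw [hv, hg, add_zero, mul_zero, nonpos_iff_eq_zero, enorm_eq_zero] at h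
    exact sub_eq_zero.1 h
  choose t ht using hΩ.exists_isTrace
  have htadd : ∀ u v, t (u + v) = t u + t v := fun u v => huniq (ht _) ((ht u).add (ht v))
  have htsmul : ∀ (c : ℝ) u, t (c • u) = c • t u := fun c u => huniq (ht _) ((ht u).smul c)
  let l₀ : H1 Ω →ₗ[ℝ] L2Bdry Ω := ⟨⟨t, htadd⟩, htsmul⟩
  let l : Sobolev Ω →ₗ[ℝ] L2Bdry Ω := l₀.comp (toSobolev Ω).symm.toLinearMap
  refine ⟨l.mkContinuous (C.toReal * 2) fun U => ?_, fun u τ => ⟨fun h => huniq (ht u) h, ?_⟩⟩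
  · obtain ⟨u, rfl⟩ := (toSobolev Ω).surjective U
    have h := (ht u).enorm_le hCt hC
    rw [← ofReal_norm, ← ofReal_norm, ← ofReal_norm, ← ENNReal.ofReal_add (norm_nonneg _)
      (norm_nonneg _), ← ENNReal.ofReal_toReal hCt, ← ENNReal.ofReal_mul ENNReal.toReal_nonneg,
      ENNReal.ofReal_le_ofReal_iff (by positivity)] at h
    refine h.trans ?_
    rw [mul_assoc]
    refine mul_le_mul_of_nonneg_left ?_ ENNReal.toReal_nonneg
    linarith [norm_val_le u, norm_grad_le u]
  · rintro rfl
    exact ht u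

end Trace

end Helmholtz

/-! ### Inverses, their derivative, and the sign of the remainder -/

namespace Helmholtz

section Inverse

variable {H : Type*} [NormedAddCommGroup H] [NormedSpace ℝ H]

theorem apply_ringInverse_apply {A : H →L[ℝ] H} (h : IsUnit A) (x : H) :
    A (Ring.inverse A x) = x :=
  congrArg (fun T : H →L[ℝ] H => T x) (Ring.mul_inverse_cancel A h)

theorem ringInverse_apply_apply {A : H →L[ℝ] H} (h : IsUnit A) (x : H) :
    Ring.inverse A (A x) = x :=
  congrArg (fun T : H →L[ℝ] H => T x) (Ring.inverse_mul_cancel A h)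

end Inverse

section Fredholm

variable {H L : Type*} [NormedAddCommGroup H] [InnerProductSpace ℝ H] [CompleteSpace H]
  [NormedAddCommGroup L] [InnerProductSpace ℝ L] [CompleteSpace L]

/-- Both subtracted terms factor through the compact `ι`, so the Fredholm alternative applies. -/
theorem isUnit_iff_of_eq_sub_adjoint {ι : H →L[ℝ] L} (hι : IsCompactOperator ι) (m : L →L[ℝ] L)
    (c : ℝ) {A : H →L[ℝ] H}
    (hA : ∀ u, A u = u - ι.adjoint (ι u) - c • ι.adjoint (m (ι u))) :
    IsUnit A ↔ ∀ u, A u = 0 → u = 0 := by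
  refine ⟨fun h u hu => ?_, fun h => ?_⟩
  · rw [← ringInverse_apply_apply h u, hu, map_zero]
  · let K : H →L[ℝ] H := (ι.adjoint + c • ι.adjoint ∘L m) ∘L ι
    have hK : IsCompactOperator K := hι.clm_comp (ι.adjoint + c • ι.adjoint ∘L m)
    have hAK : A = 1 - K := ContinuousLinearMap.ext fun u => (hA u).trans (sub_sub _ _ _)
    rw [hAK] at h ⊢
    exact isUnit_one_sub_of_injective hK h

end Fredholm

section Derivative

variable {X H G : Type*} [NormedAddCommGroup X] [NormedSpace ℝ X]
  [NormedAddCommGroup H] [NormedSpace ℝ H] [CompleteSpace H]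
  [NormedAddCommGroup G] [NormedSpace ℝ G]

/-- Derivative of `p ↦ γ (A₁ - M p)⁻¹ β`. -/
theorem hasFDerivAt_comp_ringInverse (γ : H →L[ℝ] G) (β : G →L[ℝ] H) (A₁ : H →L[ℝ] H)
    (M : X →L[ℝ] H →L[ℝ] H) {p₀ : X} (h₀ : IsUnit (A₁ - M p₀)) :
    ∃ D : X →L[ℝ] G →L[ℝ] G,
      HasFDerivAt (fun p => γ ∘L Ring.inverse (A₁ - M p) ∘L β) D p₀ ∧
      ∀ h, D h = γ ∘L (Ring.inverse (A₁ - M p₀) ∘L M h ∘L Ring.inverse (A₁ - M p₀)) ∘L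
        β := by
  obtain ⟨a, ha⟩ := h₀
  have h1 : HasFDerivAt (fun p => A₁ - M p) (-M) p₀ := by
    simpa using (M.hasFDerivAt (x := p₀)).const_sub A₁
  have h2 := hasFDerivAt_ringInverse (𝕜 := ℝ) a
  rw [ha] at h2
  have h3 := h2.comp p₀ h1
  -- The map `T ↦ γ T β` is linear. The minus sign from differentiating the inverse cancels the one
  -- from `A₁ - M p`.
  let S : (H →L[ℝ] H) →L[ℝ] (G →L[ℝ] G) := γ.postcomp G ∘L β.precomp H
  refine ⟨_, (S.hasFDerivAt.comp p₀ h3), fun h => ?_⟩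
  rw [← ha, Ring.inverse_unit]
  ext g
  simp [S]

end Derivative

section Inequality

variable {H L G : Type*} [NormedAddCommGroup H] [InnerProductSpace ℝ H] [CompleteSpace H]
  [NormedAddCommGroup L] [InnerProductSpace ℝ L] [CompleteSpace L]
  [NormedAddCommGroup G] [InnerProductSpace ℝ G]

/-- For `A` with finite dimensional negative part, the remainder
`γ (A⁻¹ - A₀⁻¹ - A₀⁻¹ (A₀ - A) A₀⁻¹) γ†` is nonnegative on the orthogonal complement of a space of
at most that dimension. -/
theorem exists_inner_remainder_nonneg {A A₀ : H →L[ℝ] H} {ι : H →L[ℝ] L} {c : ℝ} {γ : H →L[ℝ] G} {γ' : G →L[ℝ] H}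
    (hadj : ∀ g v, inner ℝ (γ' g) v = inner ℝ g (γ v))
    (hA : ∀ u v, inner ℝ (A u) v = inner ℝ (A v) u)
    (hA₀ : ∀ u v, inner ℝ (A₀ u) v = inner ℝ (A₀ v) u)
    (hι : IsCompactOperator ι) (hc : 0 < c)
    (hco : ∀ u, ‖u‖ ^ 2 ≤ inner ℝ (A u) u + c * ‖ι u‖ ^ 2) (hu : IsUnit A) (hu₀ : IsUnit A₀) :
    ∃ V : Submodule ℝ G, FiniteDimensional ℝ V ∧
      Module.finrank ℝ V ≤ Module.finrank ℝ (negativeSpan A ι) ∧ ∀ g ∈ Vᗮ,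
        0 ≤ inner ℝ g ((γ ∘L Ring.inverse A ∘L γ' - γ ∘L Ring.inverse A₀ ∘L γ'
          - γ ∘L (Ring.inverse A₀ ∘L (A₀ - A) ∘L Ring.inverse A₀) ∘L γ') g) := by
  have hfin := finiteDimensional_negativeSpan hA hι hc hco
  have hR := apply_ringInverse_apply hu
  have hR₀ := apply_ringInverse_apply hu₀
  -- Orthogonality of `g` to `W φ` is the condition `⟨A (u - u₀), φ⟩ = 0` moved to the boundary.
  let W : H →L[ℝ] G := γ ∘L Ring.inverse A₀ ∘L (A₀ - A)
  refine ⟨(negativeSpan A ι).map (W : H →ₗ[ℝ] G), inferInstance,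
    Submodule.finrank_map_le _ _, fun g hg => ?_⟩
  set u := Ring.inverse A (γ' g) with hudef
  set u₀ := Ring.inverse A₀ (γ' g) with hu₀def
  have hAu : A u = γ' g := hR _
  have hAu₀ : A₀ u₀ = γ' g := hR₀ _
  have hAw : A (u - u₀) = A₀ u₀ - A u₀ := by rw [map_sub, hAu, hAu₀]
  have hw : 0 ≤ inner ℝ (A (u - u₀)) (u - u₀) := by
    refine inner_self_nonneg_of_orthogonal_negativeSpan hA hι hc hco fun φ hφ => ?_
    have hW : ∀ φ ∈ negativeSpan A ι, inner ℝ (A (u - u₀)) φ = (0 : ℝ) := by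
      intro φ hφ
      have h1 : inner ℝ (W φ) g = (0 : ℝ) := hg _ (Submodule.mem_map_of_mem hφ)
      have h2 : inner ℝ (W φ) g = inner ℝ (A₀ u₀) (Ring.inverse A₀ (A₀ φ - A φ)) := by
        rw [hAu₀, hadj, real_inner_comm]; rfl
      rw [h2, hA₀, hR₀, inner_sub_left, hA₀ φ, hA φ] at h1
      rw [hAw, inner_sub_left, h1]
    induction hφ using Submodule.span_induction with
    | mem φ h =>
      have h0 := hW φ (Submodule.subset_span h)
      obtain ⟨μ, hμ, hφ⟩ := h
      rw [hA, hφ] at h0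
      rw [real_inner_comm]
      -- For an eigenvector, `⟨A (u - u₀), φ⟩` is `μ` times the `L` product, and `μ ≠ 0`.
      exact (mul_eq_zero.1 h0).resolve_left hμ.ne
    | zero => rw [map_zero, inner_zero_right]
    | add x y _ _ hx hy => rw [map_add, inner_add_right, hx, hy, add_zero]
    | smul a x _ hx => rw [map_smul, real_inner_smul_right, hx, mul_zero]
  -- It remains to identify the remainder with the form at `u - u₀`. With `f = γ' g`, both equal
  -- `⟨f, u⟩ - 2 ⟨f, u₀⟩ + ⟨A u₀, u₀⟩`.
  convert hw using 1
  set z := Ring.inverse A₀ (A₀ u₀ - A u₀) with hz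
  have hAz : A₀ z = A₀ u₀ - A u₀ := hR₀ _
  have e : ((γ ∘L Ring.inverse A ∘L γ' - γ ∘L Ring.inverse A₀ ∘L γ'
          - γ ∘L (Ring.inverse A₀ ∘L (A₀ - A) ∘L Ring.inverse A₀) ∘L γ') g)
      = γ (u - u₀ - z) := by
    simp [u, u₀, z]
  rw [e, ← hadj, inner_sub_right, ← hAu₀, hA₀ u₀ z, hAz, hAw, inner_sub_right, inner_sub_right,
    inner_sub_left, inner_sub_left, hA u₀ u, hAu, ← hAu₀, hA₀ u₀ u, hA₀ u₀ u₀]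

end Inequality

end Helmholtz

/-! ### The Neumann problem as an operator equation -/

namespace Helmholtz

variable {n : ℕ} {Ω : Set (E n)}

/-- A Hilbert space isomorphic to `H¹(Ω)`, with its embedding into `L²(Ω)` and its trace operator. -/
structure HilbertModel (Ω : Set (E n)) (H : Type*) [NormedAddCommGroup H]
    [InnerProductSpace ℝ H] where
  equiv : H1 Ω ≃ₗ[ℝ] H
  incl : H →L[ℝ] L2 Ω
  trace : H →L[ℝ] L2Bdry Ω
  inner_equiv : ∀ u v : H1 Ω, inner ℝ (equiv u) (equiv v)
    = inner ℝ (val u) (val v) + inner ℝ (grad u) (grad v)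
  incl_equiv : ∀ u : H1 Ω, incl (equiv u) = val u
  isCompactOperator_incl : IsCompactOperator incl
  isTrace_iff : ∀ (u : H1 Ω) (τ : L2Bdry Ω), IsTrace u τ ↔ trace (equiv u) = τ

section Multiplication

/-- Multiplication by a bounded function, as a bounded operator on `L²(Ω)`. -/
def mulL (Ω : Set (E n)) : LInf Ω →L[ℝ] L2 Ω →L[ℝ] L2 Ω :=
  (ContinuousLinearMap.mul ℝ ℝ).holderL (volume.restrict Ω) ⊤ 2 2

theorem coeFn_mulL (q : LInf Ω) (f : L2 Ω) :
    mulL Ω q f =ᵐ[volume.restrict Ω] fun x => q x * f x :=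
  (ContinuousLinearMap.mul ℝ ℝ).coeFn_holder q f

theorem inner_mulL_left (q : LInf Ω) (f g : L2 Ω) :
    inner ℝ (mulL Ω q f) g = ∫ x in Ω, q x * f x * g x := by
  rw [L2.inner_def]
  refine integral_congr_ae ?_
  filter_upwards [coeFn_mulL q f] with x hx
  rw [hx, RCLike.inner_apply, conj_trivial, mul_comm]

theorem inner_mulL_comm (q : LInf Ω) (f g : L2 Ω) :
    inner ℝ (mulL Ω q f) g = inner ℝ (mulL Ω q g) f := by
  rw [inner_mulL_left, inner_mulL_left]
  simp only [mul_right_comm]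

theorem norm_mulL_le (q : LInf Ω) (f : L2 Ω) : ‖mulL Ω q f‖ ≤ ‖q‖ * ‖f‖ := by
  have h := (ContinuousLinearMap.mul ℝ ℝ).norm_holder_apply_apply_le (r := 2) q f
  refine h.trans ?_
  rw [mul_assoc]
  exact mul_le_of_le_one_left (by positivity) (ContinuousLinearMap.opNorm_mul_le ℝ ℝ)

theorem inner_val_eq_integral (u v : H1 Ω) :
    inner ℝ (val u) (val v) = ∫ x in Ω, val u x * val v x := by
  rw [L2.inner_def]
  refine integral_congr_ae (.of_forall fun x => ?_)
  simp only [RCLike.inner_apply, conj_trivial, mul_comm]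

theorem form_eq_inner (k : ℝ) (q : LInf Ω) (u v : H1 Ω) :
    form k q u v = inner ℝ (grad u) (grad v) - k ^ 2 * inner ℝ (mulL Ω q (val u)) (val v) := by
  have h1 : Integrable (fun x => inner ℝ (grad u x) (grad v x)) (volume.restrict Ω) :=
    L2.integrable_inner (𝕜 := ℝ) (grad u) (grad v)
  have h2 : Integrable (fun x => q x * val u x * val v x) (volume.restrict Ω) := by
    refine (L2.integrable_inner (𝕜 := ℝ) (mulL Ω q (val u)) (val v)).congr ?_
    filter_upwards [coeFn_mulL q (val u)] with x hx
    rw [hx, RCLike.inner_apply, conj_trivial, mul_comm]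
  rw [inner_mulL_left, L2.inner_def, ← integral_const_mul, ← integral_sub h1 (h2.const_mul _), form]
  simp only [mul_assoc]

end Multiplication

theorem isNtD_ntd {k : ℝ} {q : LInf Ω} {T : L2Bdry Ω →L[ℝ] L2Bdry Ω} (hT : IsNtD k q T) :
    IsNtD k q (ntd k q) := by
  have h : ∃ T, IsNtD k q T := ⟨T, hT⟩
  rw [ntd, dif_pos h]
  exact h.choose_spec

namespace HilbertModel

variable {H : Type*} [NormedAddCommGroup H] [InnerProductSpace ℝ H]

theorem isNtD_unique (S : HilbertModel Ω H) {k : ℝ} {q : LInf Ω}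
    {T T' : L2Bdry Ω →L[ℝ] L2Bdry Ω} (hT : IsNtD k q T) (hT' : IsNtD k q T') : T = T' := by
  ext1 g
  obtain ⟨u, ⟨-, hu⟩, hτ⟩ := hT g
  obtain ⟨u', ⟨hu', -⟩, hτ'⟩ := hT' g
  rw [hu u' hu'] at hτ'
  exact ((S.isTrace_iff u _).1 hτ).symm.trans ((S.isTrace_iff u _).1 hτ')

variable [CompleteSpace H] (S : HilbertModel Ω H)

/-- The operator on `H¹(Ω)` that represents `k² ∫_Ω q u v`. -/
def potentialOp (k : ℝ) : LInf Ω →L[ℝ] H →L[ℝ] H :=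
  k ^ 2 • (S.incl.adjoint.postcomp H ∘L S.incl.precomp (L2 Ω) ∘L mulL Ω)

theorem potentialOp_apply (k : ℝ) (q : LInf Ω) (U : H) :
    S.potentialOp k q U = k ^ 2 • S.incl.adjoint (mulL Ω q (S.incl U)) := rfl

theorem inner_potentialOp (k : ℝ) (q : LInf Ω) (U V : H) :
    inner ℝ (S.potentialOp k q U) V = k ^ 2 * inner ℝ (mulL Ω q (S.incl U)) (S.incl V) := by
  rw [potentialOp_apply, real_inner_smul_left, ContinuousLinearMap.adjoint_inner_left]

/-- The operator on `H¹(Ω)` that represents `∫_Ω ∇u · ∇v`. -/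
def stiffnessOp : H →L[ℝ] H :=
  1 - S.incl.adjoint ∘L S.incl

theorem inner_stiffnessOp (U V : H) :
    inner ℝ (S.stiffnessOp U) V = inner ℝ U V - inner ℝ (S.incl U) (S.incl V) := by
  change inner ℝ (U - S.incl.adjoint (S.incl U)) V = _
  rw [inner_sub_left, ContinuousLinearMap.adjoint_inner_left]

/-- The operator on `H¹(Ω)` that represents `form k q`. -/
def helmholtzOp (k : ℝ) (q : LInf Ω) : H →L[ℝ] H :=
  S.stiffnessOp - S.potentialOp k q

theorem inner_helmholtzOp (k : ℝ) (q : LInf Ω) (U V : H) :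
    inner ℝ (S.helmholtzOp k q U) V = inner ℝ U V - inner ℝ (S.incl U) (S.incl V)
      - k ^ 2 * inner ℝ (mulL Ω q (S.incl U)) (S.incl V) := by
  rw [helmholtzOp, sub_apply, inner_sub_left, inner_stiffnessOp,
    inner_potentialOp]

theorem inner_helmholtzOp_comm (k : ℝ) (q : LInf Ω) (U V : H) :
    inner ℝ (S.helmholtzOp k q U) V = inner ℝ (S.helmholtzOp k q V) U := by
  rw [inner_helmholtzOp, inner_helmholtzOp, inner_mulL_comm, real_inner_comm,
    real_inner_comm (S.incl V)]

theorem inner_helmholtzOp_equiv (k : ℝ) (q : LInf Ω) (u v : H1 Ω) :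
    inner ℝ (S.helmholtzOp k q (S.equiv u)) (S.equiv v) = form k q u v := by
  have h1 := S.inner_helmholtzOp k q (S.equiv u) (S.equiv v)
  simp only [S.incl_equiv] at h1
  have h2 := S.inner_equiv u v
  have h3 := form_eq_inner k q u v
  linarith

/-- Gårding inequality: the `1` restores the `L²` part of the `H¹` norm and `k² ‖q‖` absorbs the
potential. -/
theorem sq_norm_le_helmholtzOp (k : ℝ) (q : LInf Ω) (U : H) :
    ‖U‖ ^ 2 ≤ inner ℝ (S.helmholtzOp k q U) U + (1 + k ^ 2 * ‖q‖) * ‖S.incl U‖ ^ 2 := by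
  have h : inner ℝ (mulL Ω q (S.incl U)) (S.incl U) ≤ ‖q‖ * ‖S.incl U‖ ^ 2 :=
    (real_inner_le_norm _ _).trans <| by
      rw [sq, ← mul_assoc]
      exact mul_le_mul_of_nonneg_right (norm_mulL_le q _) (norm_nonneg _)
  rw [inner_helmholtzOp, real_inner_self_eq_norm_sq, real_inner_self_eq_norm_sq]
  have := mul_le_mul_of_nonneg_left h (sq_nonneg k)
  nlinarith

theorem mem_ntdDomain_iff {k : ℝ} {q : LInf Ω} :
    q ∈ ntdDomain Ω k ↔ ∀ U : H, S.helmholtzOp k q U = 0 → U = 0 := by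
  constructor
  · intro hq U hU
    obtain ⟨u, rfl⟩ := S.equiv.surjective U
    by_contra hu
    refine hq ⟨u, fun h => hu (by rw [h, map_zero]), fun v => ?_⟩
    rw [← S.inner_helmholtzOp_equiv, hU, inner_zero_left]
  · rintro h ⟨u, hu, hv⟩
    refine hu (S.equiv.map_eq_zero_iff.1 (h _ (ext_inner_right ℝ fun V => ?_)))
    obtain ⟨v, rfl⟩ := S.equiv.surjective V
    rw [S.inner_helmholtzOp_equiv, hv, inner_zero_left]

theorem mem_ntdDomain_iff_isUnit {k : ℝ} {q : LInf Ω} : q ∈ ntdDomain Ω k ↔ IsUnit (S.helmholtzOp k q) := by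
  exact S.mem_ntdDomain_iff.trans (isUnit_iff_of_eq_sub_adjoint S.isCompactOperator_incl
    (mulL Ω q) (k ^ 2) fun U => rfl).symm

/-- The adjoint of the trace operator. -/
def lift : L2Bdry Ω →L[ℝ] H := S.trace.adjoint

theorem inner_lift (g : L2Bdry Ω) (U : H) : inner ℝ (S.lift g) U = inner ℝ g (S.trace U) :=
  ContinuousLinearMap.adjoint_inner_left S.trace U g

theorem inner_lift_equiv (g : L2Bdry Ω) (v : H1 Ω) :
    inner ℝ (S.lift g) (S.equiv v) = ∫ x, g x * S.trace (S.equiv v) x ∂(surfaceMeasure Ω) := by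
  rw [inner_lift, L2.inner_def]
  refine integral_congr_ae (.of_forall fun x => ?_)
  simp only [RCLike.inner_apply, conj_trivial, mul_comm]

theorem isWeakSolution_iff {k : ℝ} {q : LInf Ω} {g : L2Bdry Ω} {u : H1 Ω} :
    IsWeakSolution k q g u ↔ S.helmholtzOp k q (S.equiv u) = S.lift g := by
  constructor
  · intro hu
    refine ext_inner_right ℝ fun V => ?_
    obtain ⟨v, rfl⟩ := S.equiv.surjective V
    exact (S.inner_helmholtzOp_equiv k q u v).trans
      ((hu v (S.trace (S.equiv v)) ((S.isTrace_iff v _).2 rfl)).trans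
        (S.inner_lift_equiv g v).symm)
  · intro hu v τ hτ
    have h1 := S.inner_lift_equiv g v
    rw [← hu, (S.isTrace_iff v τ).1 hτ] at h1
    exact (S.inner_helmholtzOp_equiv k q u v).symm.trans h1

/-- With `γ` the trace operator, `γ A⁻¹ γ†` is the Neumann-to-Dirichlet operator, where `A`
represents `form k q`. -/
theorem isNtD_of_isUnit {k : ℝ} {q : LInf Ω} (h : IsUnit (S.helmholtzOp k q)) :
    IsNtD k q (S.trace ∘L Ring.inverse (S.helmholtzOp k q) ∘L S.lift) := by
  intro g
  obtain ⟨u, hu⟩ := S.equiv.surjective (Ring.inverse (S.helmholtzOp k q) (S.lift g))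
  have hAu : S.helmholtzOp k q (S.equiv u) = S.lift g :=
    (congrArg (S.helmholtzOp k q) hu).trans (apply_ringInverse_apply h _)
  refine ⟨u, ⟨S.isWeakSolution_iff.2 hAu, fun u' hu' => S.equiv.injective ?_⟩,
    (S.isTrace_iff u _).2 (congrArg S.trace hu)⟩
  rw [← ringInverse_apply_apply h (S.equiv u'), S.isWeakSolution_iff.1 hu', ← hAu,
    ringInverse_apply_apply h]

theorem ntd_eq_of_isUnit {k : ℝ} {q : LInf Ω}
    (h : IsUnit (S.helmholtzOp k q)) :
    ntd k q = S.trace ∘L Ring.inverse (S.helmholtzOp k q) ∘L S.lift :=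
  have hT := S.isNtD_of_isUnit h
  S.isNtD_unique (isNtD_ntd hT) hT

theorem continuous_helmholtzOp (k : ℝ) : Continuous (S.helmholtzOp k) :=
  continuous_const.sub (S.potentialOp k).continuous

/-- Invertible operators form an open set, so the formula holds near `q₀` and the derivative of
`ntd` can be read off from it. -/
theorem ntd_eventuallyEq {k : ℝ} {q₀ : LInf Ω}
    (h : IsUnit (S.helmholtzOp k q₀)) :
    ntd k =ᶠ[𝓝 q₀] fun q => S.trace ∘L Ring.inverse (S.helmholtzOp k q) ∘L S.lift := by
  filter_upwards [(S.continuous_helmholtzOp k).continuousAt.preimage_mem_nhds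
    (Units.isOpen.mem_nhds h)] with q hq
  exact S.ntd_eq_of_isUnit hq

theorem map_negativeEigenspaces (k : ℝ) (q : LInf Ω) :
    (negativeEigenspaces k q).map (S.equiv : H1 Ω →ₗ[ℝ] H)
      = negativeSpan (S.helmholtzOp k q) S.incl := by
  rw [negativeEigenspaces, negativeSpan, Submodule.map_span]
  have key : ∀ (u : H1 Ω) (μ : ℝ), (∀ V, inner ℝ (S.helmholtzOp k q (S.equiv u)) V
      = μ * inner ℝ (S.incl (S.equiv u)) (S.incl V)) ↔
      ∀ v : H1 Ω, form k q u v = μ * ∫ x in Ω, val u x * val v x := by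
    intro u μ
    rw [S.equiv.surjective.forall]
    refine forall_congr' fun v => ?_
    rw [S.inner_helmholtzOp_equiv, S.incl_equiv, S.incl_equiv, inner_val_eq_integral]
  refine le_antisymm (Submodule.span_mono ?_) (Submodule.span_le.2 ?_)
  · rintro _ ⟨u, ⟨μ, hμ, -, hu⟩, rfl⟩
    exact ⟨μ, hμ, (key u μ).2 hu⟩
  · rintro U ⟨μ, hμ, hU⟩
    obtain ⟨u, rfl⟩ := S.equiv.surjective U
    -- Eigenfunctions are nonzero by definition, whereas the generators of `negativeSpan` include
    -- zero; the spans agree all the same.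
    by_cases h0 : u = 0
    · rw [h0, map_zero]; exact Submodule.zero_mem _
    · exact Submodule.subset_span ⟨u, ⟨μ, hμ, h0, (key u μ).1 hU⟩, rfl⟩

/-- The Neumann-to-Dirichlet map is differentiable, and its remainder is nonnegative up to a space
of dimension `numNegativeEigenvalues k q`. -/
theorem differentiableAt_ntd_and_remainder_nonneg (S : HilbertModel Ω H)
    {k : ℝ} {q q₀ : LInf Ω} 
    (hq : q ∈ ntdDomain Ω k) (hq₀ : q₀ ∈ ntdDomain Ω k) :
    (∀ p ∈ ntdDomain Ω k, IsNtD k p (ntd k p)) ∧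
    DifferentiableAt ℝ (fun p : LInf Ω => ntd k p) q₀ ∧
    FiniteDimensional ℝ (negativeEigenspaces k q) ∧
    ∃ V₁ : Submodule ℝ (L2Bdry Ω),
      FiniteDimensional ℝ V₁ ∧ Module.finrank ℝ V₁ ≤ numNegativeEigenvalues k q ∧
      ∀ g ∈ V₁ᗮ,
        0 ≤ ∫ x, g x * ((ntd k q - ntd k q₀
              - fderiv ℝ (fun p : LInf Ω => ntd k p) q₀ (q - q₀)) g) x
            ∂(surfaceMeasure Ω) := by
  have hu := S.mem_ntdDomain_iff_isUnit.1 hq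
  have hu₀ := S.mem_ntdDomain_iff_isUnit.1 hq₀
  obtain ⟨D, hD, hDh⟩ := hasFDerivAt_comp_ringInverse S.trace S.lift (S.stiffnessOp) (S.potentialOp k) hu₀
  have hd : HasFDerivAt (fun p : LInf Ω => ntd k p) D q₀ :=
    hD.congr_of_eventuallyEq (S.ntd_eventuallyEq hu₀)
  have hc : 0 < 1 + k ^ 2 * ‖q‖ := by positivity
  have hι := S.isCompactOperator_incl
  have hfin := finiteDimensional_negativeSpan (S.inner_helmholtzOp_comm k q) hι hc
    (S.sq_norm_le_helmholtzOp k q)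
  let e : negativeEigenspaces k q ≃ₗ[ℝ] negativeSpan (S.helmholtzOp k q) S.incl :=
    (S.equiv.submoduleMap _).trans (LinearEquiv.ofEq _ _ (S.map_negativeEigenspaces k q))
  refine ⟨fun p hp => isNtD_ntd (S.isNtD_of_isUnit (S.mem_ntdDomain_iff_isUnit.1 hp)),
    hd.differentiableAt, e.symm.finiteDimensional, ?_⟩
  obtain ⟨V, hV, hVd, hVg⟩ := exists_inner_remainder_nonneg S.inner_lift (S.inner_helmholtzOp_comm k q)
    (S.inner_helmholtzOp_comm k q₀) hι hc (S.sq_norm_le_helmholtzOp k q) hu hu₀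
  refine ⟨V, hV, hVd.trans e.finrank_eq.ge, fun g hg => ?_⟩
  refine (hVg g hg).trans_eq ?_
  -- The operator is affine in the potential, so the increment `q - q₀` in the derivative is
  -- represented by `A₀ - A`.
  have hB : S.helmholtzOp k q₀ - S.helmholtzOp k q = S.potentialOp k (q - q₀) := by
    rw [map_sub, helmholtzOp, helmholtzOp, sub_sub_sub_cancel_left]
  rw [hd.fderiv, hDh, S.ntd_eq_of_isUnit hu, S.ntd_eq_of_isUnit hu₀, hB, L2.inner_def]
  refine integral_congr_ae (.of_forall fun x => ?_)
  simp only [RCLike.inner_apply, conj_trivial, mul_comm]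
  rfl

end HilbertModel

end Helmholtz

end

theorem theorem2p3 {n : ℕ} (hn : 2 ≤ n) (Ω : Set (Helmholtz.E n))
    (hΩ : Helmholtz.IsBoundedLipschitzDomain Ω) (k : ℝ) (hk : 0 < k)
    (q q₀ : Helmholtz.LInf Ω)
    (hq : q ∈ Helmholtz.ntdDomain Ω k) (hq₀ : q₀ ∈ Helmholtz.ntdDomain Ω k) :
    -- `Λ(p)` is a well-defined bounded operator for every `p ∈ 𝒟(Λ)`
    (∀ p ∈ Helmholtz.ntdDomain Ω k, Helmholtz.IsNtD k p (Helmholtz.ntd k p)) ∧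
    -- `Λ` is Fréchet differentiable at `q₀`, so that `Λ'(q₀)` makes sense
    DifferentiableAt ℝ (fun p : Helmholtz.LInf Ω => Helmholtz.ntd k p) q₀ ∧
    -- `d(q)` is finite
    FiniteDimensional ℝ (Helmholtz.negativeEigenspaces k q) ∧
    ∃ V₁ : Submodule ℝ (Helmholtz.L2Bdry Ω),
      FiniteDimensional ℝ V₁ ∧ Module.finrank ℝ V₁ ≤ Helmholtz.numNegativeEigenvalues k q ∧
      ∀ g ∈ V₁ᗮ,
        0 ≤ ∫ x, g x * ((Helmholtz.ntd k q - Helmholtz.ntd k q₀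
              - fderiv ℝ (fun p : Helmholtz.LInf Ω => Helmholtz.ntd k p) q₀ (q - q₀)) g) x
            ∂(Helmholtz.surfaceMeasure Ω) := by
  obtain ⟨γ, hγ⟩ := hΩ.exists_trace
  let S : Helmholtz.HilbertModel Ω (Helmholtz.Sobolev Ω) :=
    { equiv := Helmholtz.toSobolev Ω
      incl := Helmholtz.valL Ω
      trace := γ
      inner_equiv := Helmholtz.inner_toSobolev
      incl_equiv := Helmholtz.valL_toSobolev
      isCompactOperator_incl := hΩ.isCompactOperator_valL
      isTrace_iff := hγ }
  exact S.differentiableAt_ntd_and_remainder_nonneg hq hq₀
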